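/- Let $(S,T)$ be a closed connected triangulated surface: finitely many triangles have their sides glued in pairs by affine identifications (each side to exactly one other side), and $S$ is homeomorphic to the resulting space. (Every simplicial triangulation of a closed surface is of this kind; a triangle may also be glued to itself, and simplices may share several faces.) Let $E$ be the set of edges. For $K^2=\mathbf E^2,\mathbf S^2$ or $\mathbf H^2$ (Euclidean plane, unit sphere, hyperbolic plane of curvature $-1$), a $K^2$ polyhedral metric on $(S,T)$ is a map $l:E\to\mathbf R$ (the edge length function) such that, for the three edges $e_i,e_j,e_k$ of any triangle of $T$, in any order, $l(e_i)+l(e_j)>l(e_k)$ and, if $K^2=\mathbf S^2$, also $l(e_i)+l(e_j)+l(e_k)<2\pi$. Each triangle of $T$ is then given the inner angles of a triangle in $K^2$ with these side lengths. For $h\in\mathbf R$ the $\phi_h$ and $\psi_h$ curvatures of $l$ are the functions on $E$ $$\phi_h(e)=\int_{\pi/2}^{a}\sin^h(t)\,dt+\int_{\pi/2}^{a'}\sin^h(t)\,dt,\qquad \psi_h(e)=\int_0^{\frac{b+c-a}{2}}\cos^h(t)\,dt+\int_0^{\frac{b'+c'-a'}{2}}\cos^h(t)\,dt,$$ where, for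 the two triangle sides glued to form $e$, $a,a'$ are the inner angles facing $e$ and $b,c$ and $b',c'$ are the inner angles adjacent to $e$ in the respective triangles. Then for every $h\in\mathbf R$: (1) if two Euclidean polyhedral metrics $l_1,l_2$ on $(S,T)$ have the same $\phi_h$ curvature, then $l_2=c\,l_1$ for some constant $c>0$, so the metrics agree up to isometry and scaling; (2) if two spherical polyhedral metrics $l_1,l_2$ on $(S,T)$ have the same $\phi_h$ curvature, then $l_1=l_2$, so the metrics are isometric; (3) if two hyperbolic polyhedral metrics $l_1,l_2$ on $(S,T)$ have the same $\psi_h$ curvature, then $l_1=l_2$, so the metrics are isometric. -/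

import Mathlib

open scoped Real

noncomputable section

/-! ### Closed triangulated surfaces -/

/-- Combinatorial pattern for gluing the sides of a family `F` of triangles in pairs.
The corners of each triangle are numbered by `Fin 3`, and the side `(f, i)` of the triangle `f` is
the one opposite to the corner `i`; its end points are the corners `i + 1` and `i + 2`.
Every side is glued to exactly one other side (possibly of the same triangle). -/
structure SideGluing (F : Type*) where
  /-- the side to which a given side is glued -/
  glue : F × Fin 3 → F × Fin 3
  glue_glue : ∀ s, glue (glue s) = s
  glue_ne : ∀ s, glue s ≠ s
  /-- the direction in which a side `(f, i)` is glued to its partner `(g, j)`: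
  `false`: the corners `i + 1`, `i + 2` go to `j + 1`, `j + 2`;
  `true`: the corners `i + 1`, `i + 2` go to `j + 2`, `j + 1`. -/
  flip : F × Fin 3 → Bool
  flip_glue : ∀ s, flip (glue s) = flip s

namespace SideGluing

variable {F : Type*} (G : SideGluing F)

/-- The points `p` and `q` of the disjoint union of the triangles (in barycentric coordinates) lie
on two sides that are glued together, and they are matched by the affine gluing map. -/
def Glued (p q : Σ _ : F, stdSimplex ℝ (Fin 3)) : Prop :=
  ∃ i j : Fin 3, G.glue (p.1, i) = (q.1, j) ∧ p.2.1 i = 0 ∧ q.2.1 j = 0 ∧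
    if G.flip (p.1, i) then p.2.1 (i + 1) = q.2.1 (j + 2) ∧ p.2.1 (i + 2) = q.2.1 (j + 1)
    else p.2.1 (i + 1) = q.2.1 (j + 1) ∧ p.2.1 (i + 2) = q.2.1 (j + 2)

/-- The space obtained from the disjoint union of the triangles by gluing their sides, with the
quotient topology. -/
abbrev Realization : Type _ := Quot G.Glued

/-- Two sides are the same edge of the glued surface. -/
def sideSetoid : Setoid (F × Fin 3) where
  r s t := t = s ∨ t = G.glue s
  iseqv :=
    { refl := fun _ => Or.inl rfl
      symm := by
        rintro s t (rfl | rfl)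
        · exact Or.inl rfl
        · exact Or.inr (G.glue_glue s).symm
      trans := by
        rintro s t r (rfl | rfl) (rfl | rfl)
        · exact Or.inl rfl
        · exact Or.inr rfl
        · exact Or.inr rfl
        · exact Or.inl (G.glue_glue s) }

/-- The set of edges: the sides of the triangles, two sides being identified when they are
glued together. -/
abbrev Edge : Type _ := Quotient G.sideSetoid

/-- The edge given by the side `i` of the triangle `f`. -/
def edge (f : F) (i : Fin 3) : G.Edge := Quotient.mk G.sideSetoid (f, i)

end SideGluing

/-- A triangulation, with set of triangles `F`, of the space `S`: triangles whose sides are glued in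
pairs, and a homeomorphism from the glued space to `S`. If `F` is finite, then `S` is
a closed surface (the links of the vertices are circles). Triangulations that are simplicial
complexes are allowed, and so are those in which a triangle meets itself or in which
two simplices share several faces. -/
structure Triangulation (S : Type*) [TopologicalSpace S] (F : Type*) extends SideGluing F where
  homeo : toSideGluing.Realization ≃ₜ S

/-! ### Polyhedral metrics and their curvatures -/

/-- The three 2-dimensional geometries of constant curvature `0`, `1`, `-1`. -/
inductive Geometry
  | euclidean
  | spherical
  | hyperbolic

/-- The inner angle, facing the side of length `a`, of a triangle with side lengths `a`, `b`, `c`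
in the given geometry. -/
def innerAngle : Geometry → ℝ → ℝ → ℝ → ℝ
  | .euclidean, a, b, c => Real.arccos ((b ^ 2 + c ^ 2 - a ^ 2) / (2 * b * c))
  | .spherical, a, b, c =>
      Real.arccos ((Real.cos a - Real.cos b * Real.cos c) / (Real.sin b * Real.sin c))
  | .hyperbolic, a, b, c =>
      Real.arccos ((Real.cosh b * Real.cosh c - Real.cosh a) / (Real.sinh b * Real.sinh c))

namespace Triangulation

variable {S : Type*} [TopologicalSpace S] {F : Type*} (T : Triangulation S F)

/-- The edge length function `l` is a polyhedral metric in the geometry `K`: in every triangle the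
triangle inequalities hold strictly and, in spherical geometry, the perimeter is less than `2π`. -/
def IsPolyhedralMetric (K : Geometry) (l : T.Edge → ℝ) : Prop :=
  (∀ f i, l (T.edge f i) < l (T.edge f (i + 1)) + l (T.edge f (i + 2))) ∧
    (K = Geometry.spherical → ∀ f, ∑ i, l (T.edge f i) < 2 * π)

/-- The inner angle of the triangle `f` at its corner `i`, that is, the one facing its side `i`. -/
def angle (K : Geometry) (l : T.Edge → ℝ) (f : F) (i : Fin 3) : ℝ :=
  innerAngle K (l (T.edge f i)) (l (T.edge f (i + 1))) (l (T.edge f (i + 2)))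

/-- The contribution of a side to the `φ_h` curvature: the integral of `sin^h` from `π/2` to the
angle facing the side. -/
def phiSide (K : Geometry) (h : ℝ) (l : T.Edge → ℝ) (s : F × Fin 3) : ℝ :=
  ∫ t in (π / 2)..(T.angle K l s.1 s.2), Real.sin t ^ h

/-- The contribution of a side to the `ψ_h` curvature: the integral of `cos^h` from `0` to
`(b + c - a) / 2`, where `a` faces the side and `b`, `c` are adjacent to it. -/
def psiSide (K : Geometry) (h : ℝ) (l : T.Edge → ℝ) (s : F × Fin 3) : ℝ :=
  ∫ t in (0 : ℝ)..((T.angle K l s.1 (s.2 + 1) + T.angle K l s.1 (s.2 + 2) - T.angle K l s.1 s.2) / 2),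
    Real.cos t ^ h

/-- The function on edges obtained by adding a function over the two sides forming an edge. -/
def edgeSum (u : F × Fin 3 → ℝ) : T.Edge → ℝ :=
  Quotient.lift (fun s => u s + u (T.glue s)) (by
    rintro s t (rfl | rfl)
    · rfl
    · simp only [T.glue_glue]
      exact add_comm _ _)

/-- The `φ_h` curvature of the metric `l`. -/
def phiCurvature (K : Geometry) (h : ℝ) (l : T.Edge → ℝ) : T.Edge → ℝ :=
  T.edgeSum (T.phiSide K h l)

/-- The `ψ_h` curvature of the metric `l`. -/
def psiCurvature (K : Geometry) (h : ℝ) (l : T.Edge → ℝ) : T.Edge → ℝ :=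
  T.edgeSum (T.psiSide K h l)

end Triangulation

end

open scoped Real

noncomputable section

open Set Filter Topology MeasureTheory intervalIntegral

/-! ### Powers of the sine -/

/-! The theorem follows from a monotonicity statement for a single triangle. Let `θ i` be the angle
facing the side `l i`, or, in the hyperbolic case, `π / 2 - (β + γ - α) / 2`. A sine law `sin (θ i)
= f (l i) * √R` holds with `f x = x`, `sin x`, `tanh (x / 2)` respectively. Let `Φ` be the primitive
of `sin ^ h` and use the coordinates `u i = ∫ f ^ (-h - 1)` for the sides. Pairing the differential
of `Φ (θ i)` with that of `u i` gives a power of `R` times `lawForm`, which is positive definite in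
the two curved geometries and has exactly the scaling direction as kernel in the Euclidean one.

Along a segment in the `u` coordinates with slopes `δ`, the sum of `Φ (θ i) * δ i` is thus
nondecreasing, so `∑ ΔΦ i * Δu i ≥ 0` for two triangles, and equality forces `δ` into the kernel at
the start. Since `u` depends on the edge only, adding over all triangles regroups the sum by edges;
equal curvatures make it vanish, so equality holds in every triangle. In the Euclidean case
connectedness then makes the scaling factor global.

The difficulty is that the set of triangles need not be convex in these coordinates. If `h > -1`,
`Φ` is continuous up to `0` and `π`, and clamped angles carry the sum through degenerate
configurations, where it takes finitely many values (`monotoneOn_of_finite_image`). If `h ≤ -1`, the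
Euclidean and hyperbolic triangle inequalities persist along the segment by concavity
(`LawPath.lt_add`), while spherical triangles are replaced by their polar triangles, which exchanges
`h` and `-h - 1`. -/

theorem continuousAt_sin_rpow (h : ℝ) {x : ℝ} (hx : Real.sin x ≠ 0) :
    ContinuousAt (fun t => Real.sin t ^ h) x :=
  Real.continuous_sin.continuousAt.rpow_const (Or.inl hx)

theorem intervalIntegrable_sin_rpow_of_mem_Ioo (h : ℝ) {x y : ℝ} (hx : x ∈ Ioo 0 π)
    (hy : y ∈ Ioo 0 π) : IntervalIntegrable (fun t => Real.sin t ^ h) volume x y := by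
  refine ContinuousOn.intervalIntegrable fun t ht => ?_
  have ht' : t ∈ Ioo 0 π := ordConnected_Ioo.uIcc_subset hx hy ht
  exact (continuousAt_sin_rpow h (Real.sin_pos_of_mem_Ioo ht').ne').continuousWithinAt

/-- For negative `h`, the inequality `sin t ≥ 2 t / π` dominates `sin ^ h` by a multiple of `t ^ h`,
which is integrable at `0` because `h > -1`. -/
theorem intervalIntegrable_sin_rpow_zero_pi_div_two {h : ℝ} (hh : -1 < h) :
    IntervalIntegrable (fun t => Real.sin t ^ h) volume 0 (π / 2) := by
  have hpi := Real.pi_pos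
  rcases le_or_gt 0 h with h0 | h0
  · exact (Real.continuous_sin.rpow_const fun _ => Or.inr h0).intervalIntegrable _ _
  · have hg : IntervalIntegrable (fun t : ℝ => (2 / π) ^ h * t ^ h) volume 0 (π / 2) :=
      (intervalIntegrable_rpow' hh).const_mul _
    refine hg.mono_fun ?_ ?_
    · exact (Real.measurable_sin.pow_const h).aestronglyMeasurable
    · refine (ae_restrict_iff' measurableSet_uIoc).2 (Eventually.of_forall fun t ht => ?_)
      rw [uIoc_of_le (by positivity)] at ht
      have ht0 : 0 < t := ht.1
      have hs : 2 / π * t ≤ Real.sin t := Real.mul_le_sin ht.1.le ht.2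
      have hp : 0 < 2 / π * t := by positivity
      have hs0 : 0 < Real.sin t := hp.trans_le hs
      beta_reduce
      rw [← Real.mul_rpow (by positivity) ht0.le, Real.norm_of_nonneg (Real.rpow_nonneg hs0.le _),
        Real.norm_of_nonneg (Real.rpow_nonneg hp.le _)]
      exact Real.rpow_le_rpow_of_nonpos hp hs h0.le

theorem intervalIntegrable_sin_rpow {h : ℝ} (hh : -1 < h) :
    IntervalIntegrable (fun t => Real.sin t ^ h) volume 0 π := by
  have h1 := intervalIntegrable_sin_rpow_zero_pi_div_two hh
  refine h1.trans ?_
  have h2 := (h1.comp_sub_left π).symm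
  simp only [Real.sin_pi_sub, sub_zero] at h2
  convert h2 using 1
  ring

/-- The primitive of `sin ^ h` vanishing at `π / 2`. -/
def sinPowPrimitive (h x : ℝ) : ℝ := ∫ t in (π / 2)..x, Real.sin t ^ h

theorem pi_div_two_mem_Ioo : π / 2 ∈ Ioo 0 π :=
  ⟨by linarith [Real.pi_pos], by linarith [Real.pi_pos]⟩

theorem hasDerivAt_sinPowPrimitive (h : ℝ) {x : ℝ} (hx : x ∈ Ioo 0 π) :
    HasDerivAt (sinPowPrimitive h) (Real.sin x ^ h) x :=
  integral_hasDerivAt_right (intervalIntegrable_sin_rpow_of_mem_Ioo h pi_div_two_mem_Ioo hx)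
    ((Real.measurable_sin.pow_const h).stronglyMeasurable.stronglyMeasurableAtFilter)
    (continuousAt_sin_rpow h (Real.sin_pos_of_mem_Ioo hx).ne')

/-- Continuity at the end points `0` and `π` is what allows degenerate triangles on a path when `h >
-1`. -/
theorem continuousOn_sinPowPrimitive {h : ℝ} (hh : -1 < h) :
    ContinuousOn (sinPowPrimitive h) (Icc 0 π) := by
  have := continuousOn_primitive_interval' (intervalIntegrable_sin_rpow hh)
    (a := π / 2) (by rw [uIcc_of_le Real.pi_pos.le]; exact Ioo_subset_Icc_self pi_div_two_mem_Ioo)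
  rwa [uIcc_of_le Real.pi_pos.le] at this

theorem sinPowPrimitive_sub (h : ℝ) {x y : ℝ} (hx : x ∈ Ioo 0 π) (hy : y ∈ Ioo 0 π) :
    sinPowPrimitive h y - sinPowPrimitive h x = ∫ t in x..y, Real.sin t ^ h :=
  integral_interval_sub_left (intervalIntegrable_sin_rpow_of_mem_Ioo h pi_div_two_mem_Ioo hy)
    (intervalIntegrable_sin_rpow_of_mem_Ioo h pi_div_two_mem_Ioo hx)

/-- Passing to the complementary angle turns the `ψ` integrals into `sinPowPrimitive`, with a change
of sign. -/
theorem integral_cos_rpow_eq (h x : ℝ) :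
    ∫ t in (0 : ℝ)..x, Real.cos t ^ h = -sinPowPrimitive h (π / 2 - x) := by
  have := integral_comp_sub_left (a := 0) (b := x) (fun t => Real.sin t ^ h) (π / 2)
  simp only [Real.sin_pi_div_two_sub, sub_zero] at this
  rw [this, sinPowPrimitive, integral_symm]

/-! ### Monotonicity away from an exceptional set with finite image -/

/-- If `m` dropped from `m x` to `m y`, some value `c` strictly between would avoid the finite set
`m '' Z`. At the last time `t` with `m t ≥ c` the value is `c`, so `t ∉ Z` and `m` is monotone near
`t`; but after `t` it stays below `c`, a contradiction. -/
theorem monotoneOn_of_finite_image {m : ℝ → ℝ} {Z : Set ℝ} {a b : ℝ}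
    (hm : ContinuousOn m (Icc a b)) (hZ : (m '' Z).Finite)
    (hopen : ∀ t ∈ Ioo a b, t ∉ Z → ∀ᶠ s in 𝓝 t, s ∉ Z)
    (hd : ∀ t ∈ Ioo a b, t ∉ Z → ∃ d, 0 ≤ d ∧ HasDerivAt m d t) :
    MonotoneOn m (Icc a b) := by
  intro x hx y hy hxy
  by_contra! hlt
  obtain ⟨c, hc, hcZ⟩ : ∃ c ∈ Ioo (m y) (m x), c ∉ m '' Z :=
    ((Ioo_infinite hlt).sdiff hZ).nonempty
  have hsub : Icc x y ⊆ Icc a b := Icc_subset_Icc hx.1 hy.2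
  have hmxy := hm.mono hsub
  have hK : IsCompact {t ∈ Icc x y | c ≤ m t} := by
    have := hmxy.preimage_isClosed_of_isClosed isClosed_Icc (isClosed_Ici (a := c))
    exact isCompact_Icc.of_isClosed_subset this inter_subset_left
  obtain ⟨t, ⟨htI, htc⟩, hmax⟩ := hK.exists_isGreatest ⟨x, ⟨le_rfl, hxy⟩, hc.2.le⟩
  have hty : t < y := lt_of_le_of_ne htI.2 (by rintro rfl; exact absurd htc (not_le.2 hc.1))
  have hafter : ∀ s ∈ Ioc t y, m s < c := fun s hs => by
    by_contra! hcs
    exact absurd (hmax ⟨⟨htI.1.trans hs.1.le, hs.2⟩, hcs⟩) (not_le.2 hs.1)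
  have hmt : m t = c := by
    refine le_antisymm ?_ htc
    have hcw : Tendsto m (𝓝[Ioc t y] t) (𝓝 (m t)) :=
      (hmxy t htI).mono_left (nhdsWithin_mono _ fun s hs => ⟨htI.1.trans hs.1.le, hs.2⟩)
    have : (𝓝[Ioc t y] t).NeBot := by
      rw [nhdsWithin_Ioc_eq_nhdsGT hty]; infer_instance
    exact le_of_tendsto hcw (eventually_nhdsWithin_of_forall fun s hs => (hafter s hs).le)
  have htx : x < t := lt_of_le_of_ne htI.1 (by rintro rfl; exact hc.2.ne hmt.symm)
  have htab : t ∈ Ioo a b := ⟨hx.1.trans_lt htx, hty.trans_le hy.2⟩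
  have htZ : t ∉ Z := fun h => hcZ ⟨t, h, hmt⟩
  obtain ⟨l, r, ⟨hlt', htr⟩, hlr⟩ := mem_nhds_iff_exists_Ioo_subset.1
    ((hopen t htab htZ).and (Ioo_mem_nhds htx hty))
  obtain ⟨s, hts, hsr⟩ := exists_between htr
  have hsub' : Icc t s ⊆ Ioo l r := fun z hz => ⟨hlt'.trans_le hz.1, hz.2.trans_lt hsr⟩
  have key : ∀ z ∈ Icc t s, z ∉ Z ∧ z ∈ Ioo x y := fun z hz => hlr (hsub' hz)
  have hder : ∀ z ∈ Icc t s, ∃ d, 0 ≤ d ∧ HasDerivAt m d z := fun z hz =>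
    hd z ⟨hx.1.trans_lt (key z hz).2.1, (key z hz).2.2.trans_le hy.2⟩ (key z hz).1
  have hmono : MonotoneOn m (Icc t s) := by
    refine monotoneOn_of_deriv_nonneg (convex_Icc t s)
      (fun z hz => (hder z hz).choose_spec.2.continuousAt.continuousWithinAt)
      (fun z hz =>
        (hder z (interior_subset hz)).choose_spec.2.differentiableAt.differentiableWithinAt)
      (fun z hz => ?_)
    obtain ⟨d, hd0, hdz⟩ := hder z (interior_subset hz)
    rwa [hdz.deriv]
  have h1 := hmono ⟨le_rfl, hts.le⟩ ⟨hts.le, le_rfl⟩ hts.le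
  have h2 := hafter s ⟨hts, (key s ⟨hts.le, le_rfl⟩).2.2.le⟩
  linarith

theorem lt_of_monotoneOn_of_hasDerivAt {m : ℝ → ℝ} {a b d : ℝ} (hab : a < b)
    (hm : MonotoneOn m (Icc a b)) (hd : HasDerivAt m d a) (hd0 : 0 < d) : m a < m b := by
  have h1 : ∀ᶠ t in 𝓝[>] a, 0 < slope m a t :=
    (hasDerivAt_iff_tendsto_slope.1 hd |>.mono_left
      (nhdsWithin_mono _ fun t ht => ne_of_gt ht)).eventually (lt_mem_nhds hd0)
  obtain ⟨t, hst, hta, htb⟩ := (h1.and (Ioc_mem_nhdsGT hab)).exists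
  have h2 : m a < m t := by
    rw [slope_def_field] at hst
    have := (div_pos_iff_of_pos_right (sub_pos.2 hta)).1 hst
    linarith
  exact h2.trans_le (hm ⟨hta.le, htb⟩ ⟨hab.le, le_rfl⟩ htb)

/-! ### Paths that are linear in the coordinate with a given positive derivative -/

theorem intervalIntegrable_of_continuousOn_ordConnected {I : Set ℝ} {w : ℝ → ℝ}
    (hI : I.OrdConnected) (hw : ContinuousOn w I) {x y : ℝ} (hx : x ∈ I) (hy : y ∈ I) :
    IntervalIntegrable w volume x y :=
  (hw.mono (hI.uIcc_subset hx hy)).intervalIntegrable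

theorem hasDerivAt_integral_of_continuousOn {I : Set ℝ} {w : ℝ → ℝ} (hIo : IsOpen I)
    (hI : I.OrdConnected) (hw : ContinuousOn w I) {x y : ℝ} (hx : x ∈ I) (hy : y ∈ I) :
    HasDerivAt (fun z => ∫ t in x..z, w t) (w y) y :=
  integral_hasDerivAt_right (intervalIntegrable_of_continuousOn_ordConnected hI hw hx hy)
    (hw.stronglyMeasurableAtFilter hIo y hy)
    (hw.continuousAt (hIo.mem_nhds hy))

theorem strictMonoOn_integral {I : Set ℝ} {w : ℝ → ℝ} (hI : I.OrdConnected)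
    (hw : ContinuousOn w I) (hpos : ∀ x ∈ I, 0 < w x) {x : ℝ} (hx : x ∈ I) :
    StrictMonoOn (fun z => ∫ t in x..z, w t) I := by
  intro a ha b hb hab
  have h1 := integral_interval_sub_left
    (intervalIntegrable_of_continuousOn_ordConnected hI hw hx hb)
    (intervalIntegrable_of_continuousOn_ordConnected hI hw hx ha)
  have h2 : 0 < ∫ t in a..b, w t :=
    intervalIntegral_pos_of_pos_on (intervalIntegrable_of_continuousOn_ordConnected hI hw ha hb)
      (fun t ht => hpos t (hI.out ha hb (Ioo_subset_Icc_self ht))) hab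
  simp only
  linarith

/-- The path is `t ↦ V (t * U y)`, where `V` inverts the primitive `U` of `w`. The image of `U` is
an interval containing `0` and `U y`, and openness of `I` gives two-sided derivatives even at `t =
0` and `t = 1`. -/
theorem exists_path_linear_integral {I : Set ℝ} {w : ℝ → ℝ} (hIo : IsOpen I)
    (hI : I.OrdConnected) (hw : ContinuousOn w I) (hpos : ∀ x ∈ I, 0 < w x) {x y : ℝ}
    (hx : x ∈ I) (hy : y ∈ I) :
    ∃ g : ℝ → ℝ, g 0 = x ∧ g 1 = y ∧ ∀ t ∈ Icc (0 : ℝ) 1, g t ∈ I ∧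
      ∫ s in x..(g t), w s = t * ∫ s in x..y, w s ∧
      HasDerivAt g ((∫ s in x..y, w s) / w (g t)) t := by
  set U : ℝ → ℝ := fun z => ∫ s in x..z, w s with hU
  have hUd : ∀ z ∈ I, HasDerivAt U (w z) z := fun z hz =>
    hasDerivAt_integral_of_continuousOn hIo hI hw hx hz
  have hmono : StrictMonoOn U I := strictMonoOn_integral hI hw hpos hx
  have hcont : ContinuousOn U I := fun z hz => (hUd z hz).continuousAt.continuousWithinAt
  set V : ℝ → ℝ := Function.invFunOn U I
  have hV : ∀ z ∈ I, V (U z) = z := fun z hz => hmono.injOn.leftInvOn_invFunOn hz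
  have hUx : U x = 0 := by simp [hU]
  have hVI : ∀ u ∈ U '' I, V u ∈ I ∧ U (V u) = u := fun u hu =>
    ⟨Function.invFunOn_mem hu, Function.invFunOn_eq hu⟩
  have himage : (U '' I).OrdConnected :=
    (hI.isPreconnected.image U hcont).ordConnected
  have hnhds : ∀ z ∈ I, U '' I ∈ 𝓝 (U z) := by
    intro z hz
    obtain ⟨p, q, ⟨hpz, hzq⟩, hpq⟩ := mem_nhds_iff_exists_Ioo_subset.1 (hIo.mem_nhds hz)
    obtain ⟨p', hp', hp'z⟩ := exists_between hpz
    obtain ⟨q', hzq', hq'⟩ := exists_between hzq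
    have hp'I : p' ∈ I := hpq ⟨hp', hp'z.trans hzq⟩
    have hq'I : q' ∈ I := hpq ⟨hpz.trans hzq', hq'⟩
    exact mem_of_superset (Icc_mem_nhds (hmono hp'I hz hp'z) (hmono hz hq'I hzq'))
      (himage.out (mem_image_of_mem U hp'I) (mem_image_of_mem U hq'I))
  have hVmono : MonotoneOn V (U '' I) := by
    rintro _ ⟨p, hp, rfl⟩ _ ⟨q, hq, rfl⟩ hpq
    rw [hV p hp, hV q hq]
    exact (hmono.le_iff_le hp hq).1 hpq
  have hVim : V '' (U '' I) = I := by
    rw [image_image]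
    exact (image_congr fun z hz => hV z hz).trans (image_id I)
  have hVcont : ∀ z ∈ I, ContinuousAt V (U z) := fun z hz =>
    continuousAt_of_monotoneOn_of_image_mem_nhds hVmono (hnhds z hz)
      (by rw [hVim, hV z hz]; exact hIo.mem_nhds hz)
  have hVd : ∀ z ∈ I, HasDerivAt V (w z)⁻¹ (U z) := fun z hz => by
    refine HasDerivAt.of_local_left_inverse (f := U) (hVcont z hz) ?_ (hpos z hz).ne' ?_
    · rw [hV z hz]; exact hUd z hz
    · filter_upwards [hnhds z hz] with u hu using (hVI u hu).2
  have hmem : ∀ t ∈ Icc (0 : ℝ) 1, t * U y ∈ U '' I := by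
    intro t ht
    have h0 : (0 : ℝ) ∈ U '' I := ⟨x, hx, hUx⟩
    have h1 : U y ∈ U '' I := ⟨y, hy, rfl⟩
    exact himage.convex.smul_mem_of_zero_mem h0 h1 ht
  refine ⟨fun t => V (t * U y), ?_, ?_, fun t ht => ?_⟩
  · simpa only [zero_mul, hUx] using hV x hx
  · simp only [one_mul, hV y hy]
  · obtain ⟨z, hz, hzt⟩ := hmem t ht
    have hVz : V (t * U y) = z := by rw [← hzt, hV z hz]
    refine ⟨(hVI _ (hmem t ht)).1, (hVI _ (hmem t ht)).2, ?_⟩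
    have h1 : HasDerivAt (fun t => t * U y) (U y) t := by
      simpa using (hasDerivAt_id t).mul_const (U y)
    have h2 := hVd z hz
    rw [hzt] at h2
    have h3 : HasDerivAt (fun t => V (t * U y)) ((w z)⁻¹ * U y) t :=
      HasDerivAt.comp (h₂ := V) t h2 h1
    simp only [hVz]
    convert h3 using 1
    rw [div_eq_inv_mul]

/-! ### Generalized cosine laws -/

/-- The quadratic form obtained by pairing the differentials of the three cosines with the
differentials of the lengths, weighted by `f ^ (-2)`. -/
def lawForm (f : ℝ → ℝ) (y' : ℝ → ℝ → ℝ → ℝ → ℝ → ℝ → ℝ) (l v : Fin 3 → ℝ) : ℝ :=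
  -∑ i, y' (l i) (l (i + 1)) (l (i + 2)) (v i) (v (i + 1)) (v (i + 2)) * v i / f (l i) ^ 2

/-- A cosine law `y` expressing the cosine of a generalized angle of a triangle through the lengths
of the opposite side and of the other two sides, with differential `y'`, for which the sines of the
three generalized angles are proportional to the values of `f` at the opposite sides. -/
structure CosineLaw (I : Set ℝ) (f : ℝ → ℝ) (y : ℝ → ℝ → ℝ → ℝ)
    (y' : ℝ → ℝ → ℝ → ℝ → ℝ → ℝ → ℝ) (R : (Fin 3 → ℝ) → ℝ) : Prop where
  isOpen : IsOpen I
  ordConnected : I.OrdConnected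
  pos : ∀ x ∈ I, 0 < f x
  continuousOn : ContinuousOn f I
  one_sub_sq : ∀ l : Fin 3 → ℝ, (∀ i, l i ∈ I) → ∀ i,
    1 - y (l i) (l (i + 1)) (l (i + 2)) ^ 2 = f (l i) ^ 2 * R l
  hasDerivAt : ∀ (a b c : ℝ → ℝ) (a' b' c' t : ℝ), a t ∈ I → b t ∈ I → c t ∈ I →
    HasDerivAt a a' t → HasDerivAt b b' t → HasDerivAt c c' t →
    HasDerivAt (fun s => y (a s) (b s) (c s)) (y' (a t) (b t) (c t) a' b' c') t
  form_nonneg : ∀ l v : Fin 3 → ℝ, (∀ i, l i ∈ I) → 0 < R l → 0 ≤ lawForm f y' l v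

/-- The generalized angle of the triangle with side lengths `l` facing the side `i`. -/
def lawAngle (y : ℝ → ℝ → ℝ → ℝ) (l : Fin 3 → ℝ) (i : Fin 3) : ℝ :=
  Real.arccos (y (l i) (l (i + 1)) (l (i + 2)))

/-- A path of triangles along which the coordinates `∫ f ^ (-h - 1)` of the side lengths are affine
functions with slopes `δ`. -/
structure LawPath (I : Set ℝ) (f : ℝ → ℝ) (h : ℝ) (δ : Fin 3 → ℝ) (g : ℝ → Fin 3 → ℝ) : Prop where
  mem : ∀ t ∈ Icc (0 : ℝ) 1, ∀ i, g t i ∈ I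
  hasDerivAt : ∀ t ∈ Icc (0 : ℝ) 1, ∀ i,
    HasDerivAt (fun s => g s i) (δ i * f (g t i) ^ (h + 1)) t

theorem exists_lawPath {I : Set ℝ} {f : ℝ → ℝ} (hIo : IsOpen I) (hI : I.OrdConnected)
    (hpos : ∀ x ∈ I, 0 < f x) (hf : ContinuousOn f I) (h : ℝ) {l l' : Fin 3 → ℝ}
    (hl : ∀ i, l i ∈ I) (hl' : ∀ i, l' i ∈ I) :
    ∃ g : ℝ → Fin 3 → ℝ, g 0 = l ∧ g 1 = l' ∧
      LawPath I f h (fun i => ∫ s in (l i)..(l' i), f s ^ (-h - 1)) g ∧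
      ∀ t ∈ Icc (0 : ℝ) 1, ∀ i, ∫ s in (l i)..(g t i), f s ^ (-h - 1) =
        t * ∫ s in (l i)..(l' i), f s ^ (-h - 1) := by
  have hw : ContinuousOn (fun x => f x ^ (-h - 1)) I :=
    hf.rpow_const fun x hx => Or.inl (hpos x hx).ne'
  choose g hg0 hg1 hg using fun i => exists_path_linear_integral hIo hI hw
    (fun x hx => Real.rpow_pos_of_pos (hpos x hx) _) (hl i) (hl' i)
  refine ⟨fun t i => g i t, funext hg0, funext hg1, ⟨fun t ht i => (hg i t ht).1, fun t ht i => ?_⟩,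
    fun t ht i => (hg i t ht).2.1⟩
  convert (hg i t ht).2.2 using 1
  rw [div_eq_mul_inv, ← Real.rpow_neg (hpos _ (hg i t ht).1).le]
  ring_nf

namespace CosineLaw

variable {I : Set ℝ} {f : ℝ → ℝ} {y : ℝ → ℝ → ℝ → ℝ} {y' : ℝ → ℝ → ℝ → ℝ → ℝ → ℝ → ℝ}
  {R : (Fin 3 → ℝ) → ℝ}

theorem abs_lt_one (C : CosineLaw I f y y' R) {l : Fin 3 → ℝ} (hl : ∀ i, l i ∈ I) (hR : 0 < R l)
    (i : Fin 3) : |y (l i) (l (i + 1)) (l (i + 2))| < 1 := by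
  have h1 := C.one_sub_sq l hl i
  have h2 : 0 < f (l i) ^ 2 * R l := mul_pos (pow_pos (C.pos _ (hl i)) 2) hR
  rw [← sq_lt_one_iff_abs_lt_one]
  linarith

/-- As `R` does not depend on `i`, one cosine strictly between `-1` and `1` already makes the whole
configuration nondegenerate. -/
theorem pos_of_abs_lt_one (C : CosineLaw I f y y' R) {l : Fin 3 → ℝ} (hl : ∀ i, l i ∈ I)
    {i : Fin 3} (hy : |y (l i) (l (i + 1)) (l (i + 2))| < 1) : 0 < R l := by
  have h1 := C.one_sub_sq l hl i
  rw [← sq_lt_one_iff_abs_lt_one] at hy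
  exact pos_of_mul_pos_right (a := f (l i) ^ 2) (by linarith) (sq_nonneg _)

theorem lawAngle_mem_Ioo (C : CosineLaw I f y y' R) {l : Fin 3 → ℝ} (hl : ∀ i, l i ∈ I)
    (hR : 0 < R l) (i : Fin 3) : lawAngle y l i ∈ Ioo 0 π := by
  have := abs_lt.1 (C.abs_lt_one hl hR i)
  exact ⟨Real.arccos_pos.2 this.2, (Real.arccos_lt_pi).2 this.1⟩

theorem sin_lawAngle (C : CosineLaw I f y y' R) {l : Fin 3 → ℝ} (hl : ∀ i, l i ∈ I)
    (i : Fin 3) : Real.sin (lawAngle y l i) = f (l i) * √(R l) := by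
  rw [lawAngle, Real.sin_arccos, C.one_sub_sq l hl i, Real.sqrt_mul (sq_nonneg _),
    Real.sqrt_sq (C.pos _ (hl i)).le]

/-- `Real.arccos` is constant outside `[-1, 1]`, so it extends the angles continuously to
configurations that are not triangles. -/
theorem lawAngle_eq_zero_or_pi (C : CosineLaw I f y y' R) {l : Fin 3 → ℝ} (hl : ∀ i, l i ∈ I)
    (hR : R l ≤ 0) (i : Fin 3) : lawAngle y l i = 0 ∨ lawAngle y l i = π := by
  have h1 : 1 ≤ |y (l i) (l (i + 1)) (l (i + 2))| := by
    by_contra! hlt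
    exact absurd (C.pos_of_abs_lt_one hl hlt) (not_lt.2 hR)
  rcases le_abs.1 h1 with h2 | h2
  · exact Or.inl (Real.arccos_eq_zero.2 h2)
  · exact Or.inr (Real.arccos_eq_pi.2 (by linarith))

variable {h : ℝ} {δ : Fin 3 → ℝ} {g : ℝ → Fin 3 → ℝ}

theorem hasDerivAt_path (C : CosineLaw I f y y' R) (hg : LawPath I f h δ g) {t : ℝ}
    (ht : t ∈ Icc (0 : ℝ) 1) (i : Fin 3) :
    HasDerivAt (fun s => y (g s i) (g s (i + 1)) (g s (i + 2)))
      (y' (g t i) (g t (i + 1)) (g t (i + 2)) (δ i * f (g t i) ^ (h + 1))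
        (δ (i + 1) * f (g t (i + 1)) ^ (h + 1)) (δ (i + 2) * f (g t (i + 2)) ^ (h + 1))) t :=
  C.hasDerivAt _ _ _ _ _ _ t (hg.mem t ht _) (hg.mem t ht _) (hg.mem t ht _)
    (hg.hasDerivAt t ht _) (hg.hasDerivAt t ht _) (hg.hasDerivAt t ht _)

/-- The sine law gives `sin ^ h = (f * √R) ^ h`, and differentiating `arccos` divides by `f * √R`.
Writing `δ i = v i / f ^ (h + 1)`, the powers of `f` combine to `f ^ (-2)`, the weight in `lawForm`,
and `√R ^ (h - 1)` factors out. -/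
theorem hasDerivAt_sum_sinPowPrimitive (C : CosineLaw I f y y' R) (hg : LawPath I f h δ g) {t : ℝ}
    (ht : t ∈ Icc (0 : ℝ) 1) (hR : 0 < R (g t)) :
    HasDerivAt (fun s => ∑ i, sinPowPrimitive h (lawAngle y (g s) i) * δ i)
      (√(R (g t)) ^ (h - 1) * lawForm f y' (g t) (fun i => δ i * f (g t i) ^ (h + 1))) t := by
  have hl := hg.mem t ht
  have hs : 0 < √(R (g t)) := Real.sqrt_pos.2 hR
  have hi : ∀ i, HasDerivAt (fun s => sinPowPrimitive h (lawAngle y (g s) i) * δ i) _ t :=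
      fun i => by
    have hy := abs_lt.1 (C.abs_lt_one hl hR i)
    have h1 := (Real.hasDerivAt_arccos hy.1.ne' hy.2.ne).comp t (C.hasDerivAt_path hg ht i)
    exact ((hasDerivAt_sinPowPrimitive h (C.lawAngle_mem_Ioo hl hR i)).comp t h1).mul_const (δ i)
  have hsum := HasDerivAt.fun_sum (u := Finset.univ) fun i _ => hi i
  refine hsum.congr_deriv (Eq.symm ?_)
  rw [lawForm, ← Finset.sum_neg_distrib, Finset.mul_sum]
  refine Finset.sum_congr rfl fun i _ => ?_
  have hf : 0 < f (g t i) := C.pos _ (hl i)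
  rw [C.sin_lawAngle hl i, C.one_sub_sq _ hl i, Real.sqrt_mul (sq_nonneg _), Real.sqrt_sq hf.le,
    Real.mul_rpow hf.le hs.le, Real.rpow_sub_one hs.ne', Real.rpow_add_one hf.ne']
  field_simp

theorem continuousOn_sum_sinPowPrimitive (C : CosineLaw I f y y' R) (hg : LawPath I f h δ g)
    (hh : -1 < h) :
    ContinuousOn (fun s => ∑ i, sinPowPrimitive h (lawAngle y (g s) i) * δ i) (Icc 0 1) := by
  refine continuousOn_finsetSum _ fun i _ => ContinuousOn.mul ?_ continuousOn_const
  refine (continuousOn_sinPowPrimitive hh).comp (t := Icc 0 π) ?_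
    fun t _ => ⟨Real.arccos_nonneg _, Real.arccos_le_pi _⟩
  exact fun t ht => (Real.continuous_arccos.continuousAt.comp
    (C.hasDerivAt_path hg ht i).continuousAt).continuousWithinAt

theorem eventually_pos (C : CosineLaw I f y y' R) (hg : LawPath I f h δ g) {t : ℝ}
    (ht : t ∈ Ioo (0 : ℝ) 1) (hR : 0 < R (g t)) : ∀ᶠ s in 𝓝 t, 0 < R (g s) := by
  have ht' := Ioo_subset_Icc_self ht
  have h1 : ∀ᶠ s in 𝓝 t, |y (g s 0) (g s (0 + 1)) (g s (0 + 2))| < 1 :=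
    (C.hasDerivAt_path hg ht' 0).continuousAt.abs.eventually
      (gt_mem_nhds (C.abs_lt_one (hg.mem t ht') hR 0))
  filter_upwards [h1, Ioo_mem_nhds ht.1 ht.2] with s hs hsI
  exact C.pos_of_abs_lt_one (hg.mem s (Ioo_subset_Icc_self hsI)) hs

theorem monotoneOn_sum_sinPowPrimitive (C : CosineLaw I f y y' R) (hg : LawPath I f h δ g)
    (hh : -1 < h ∨ ∀ t ∈ Icc (0 : ℝ) 1, 0 < R (g t)) :
    MonotoneOn (fun s => ∑ i, sinPowPrimitive h (lawAngle y (g s) i) * δ i) (Icc 0 1) := by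
  have hd : ∀ t ∈ Icc (0 : ℝ) 1, 0 < R (g t) → ∃ d, 0 ≤ d ∧
      HasDerivAt (fun s => ∑ i, sinPowPrimitive h (lawAngle y (g s) i) * δ i) d t := fun t ht hR =>
    ⟨_, mul_nonneg (Real.rpow_nonneg (Real.sqrt_nonneg _) _)
      (C.form_nonneg _ _ (hg.mem t ht) hR), C.hasDerivAt_sum_sinPowPrimitive hg ht hR⟩
  refine monotoneOn_of_finite_image (Z := {t ∈ Icc (0 : ℝ) 1 | R (g t) ≤ 0}) ?_ ?_ ?_ ?_
  · rcases hh with hh | hR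
    · exact C.continuousOn_sum_sinPowPrimitive hg hh
    · intro t ht
      obtain ⟨d, -, hdt⟩ := hd t ht (hR t ht)
      exact hdt.continuousAt.continuousWithinAt
  -- At degenerate times each angle is `0` or `π`, so the sum takes at most eight values.
  · refine (Set.finite_range fun e : Fin 3 → Bool =>
      ∑ i, sinPowPrimitive h (if e i then π else 0) * δ i).subset ?_
    rintro _ ⟨t, ⟨ht, hR⟩, rfl⟩
    refine ⟨fun i => decide (lawAngle y (g t) i = π), Finset.sum_congr rfl fun i _ => ?_⟩
    rcases C.lawAngle_eq_zero_or_pi (hg.mem t ht) hR i with h0 | h0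
    · simp [h0, Real.pi_ne_zero.symm]
    · simp [h0]
  · intro t ht htZ
    have hR : 0 < R (g t) := by
      by_contra! hle
      exact htZ ⟨Ioo_subset_Icc_self ht, hle⟩
    filter_upwards [C.eventually_pos hg ht hR] with s hs hsZ
    exact absurd hs (not_lt.2 hsZ.2)
  · intro t ht htZ
    have hR : 0 < R (g t) := by
      by_contra! hle
      exact htZ ⟨Ioo_subset_Icc_self ht, hle⟩
    exact hd t (Ioo_subset_Icc_self ht) hR

/-- Nondegeneracy is needed at the start only: if the form is nonzero there, the sum has a positive
derivative at `0`, and monotonicity preserves this initial gain until time `1`. -/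
theorem monotonicity_of_path (C : CosineLaw I f y y' R) (hg : LawPath I f h δ g)
    (hh : -1 < h ∨ ∀ t ∈ Icc (0 : ℝ) 1, 0 < R (g t)) (hR : 0 < R (g 0)) :
    0 ≤ ∑ i, (sinPowPrimitive h (lawAngle y (g 1) i) -
      sinPowPrimitive h (lawAngle y (g 0) i)) * δ i ∧
    (∑ i, (sinPowPrimitive h (lawAngle y (g 1) i) -
      sinPowPrimitive h (lawAngle y (g 0) i)) * δ i = 0 →
      lawForm f y' (g 0) (fun i => δ i * f (g 0 i) ^ (h + 1)) = 0) := by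
  have hmono := C.monotoneOn_sum_sinPowPrimitive hg hh
  have h0 : (0 : ℝ) ∈ Icc (0 : ℝ) 1 := ⟨le_rfl, zero_le_one⟩
  have h1 : (1 : ℝ) ∈ Icc (0 : ℝ) 1 := ⟨zero_le_one, le_rfl⟩
  simp only [sub_mul, Finset.sum_sub_distrib]
  refine ⟨sub_nonneg.2 (hmono h0 h1 zero_le_one), fun heq => ?_⟩
  by_contra hne
  have hpos := (C.form_nonneg _ (fun i => δ i * f (g 0 i) ^ (h + 1)) (hg.mem 0 h0) hR).lt_of_ne' hne
  have := lt_of_monotoneOn_of_hasDerivAt zero_lt_one hmono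
    (C.hasDerivAt_sum_sinPowPrimitive hg h0 hR)
    (mul_pos (Real.rpow_pos_of_pos (Real.sqrt_pos.2 hR) _) hpos)
  linarith

end CosineLaw

/-! ### A definiteness criterion -/

/-- The ternary quadratic form with diagonal entries `p`, `q`, `r` and off-diagonal entries `a` (for
the last two variables), `b`, `c` is positive definite if its leading minors are positive. -/
theorem ternary_form_pos {p q r a b c : ℝ} (hp : 0 < p) (hpq : 0 < p * q - c ^ 2)
    (hdet : 0 < p * q * r + 2 * a * b * c - p * a ^ 2 - q * b ^ 2 - r * c ^ 2) {x y z : ℝ}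
    (h : ¬(x = 0 ∧ y = 0 ∧ z = 0)) :
    0 < p * x ^ 2 + q * y ^ 2 + r * z ^ 2 + 2 * a * y * z + 2 * b * x * z + 2 * c * x * y := by
  set S := p * x ^ 2 + q * y ^ 2 + r * z ^ 2 + 2 * a * y * z + 2 * b * x * z + 2 * c * x * y with hS
  set m := p * q - c ^ 2 with hm
  set d := p * q * r + 2 * a * b * c - p * a ^ 2 - q * b ^ 2 - r * c ^ 2 with hd
  -- Completing squares twice; the coefficients are the leading minors.
  have key : m * p * S = m * (p * x + c * y + b * z) ^ 2 + (m * y + (p * a - b * c) * z) ^ 2 +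
      p * d * z ^ 2 := by
    rw [hS, hm, hd]; ring
  have hmp : 0 < m * p := mul_pos hpq hp
  by_contra! hle
  have h0 : m * p * S ≤ 0 := mul_nonpos_of_nonneg_of_nonpos hmp.le hle
  have h1 : 0 ≤ m * (p * x + c * y + b * z) ^ 2 := mul_nonneg hpq.le (sq_nonneg _)
  have h2 := sq_nonneg (m * y + (p * a - b * c) * z)
  have h3 : 0 ≤ p * d * z ^ 2 := mul_nonneg (mul_pos hp hdet).le (sq_nonneg _)
  have hz : z = 0 := by
    have : p * d * z ^ 2 = 0 := by linarith
    simpa [hp.ne', hdet.ne'] using this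
  have hy : y = 0 := by
    have : (m * y + (p * a - b * c) * z) ^ 2 = 0 := by linarith
    simpa [hz, hpq.ne'] using this
  have hx : x = 0 := by
    have : m * (p * x + c * y + b * z) ^ 2 = 0 := by linarith
    simpa [hz, hy, hpq.ne', hp.ne'] using this
  exact h ⟨hx, hy, hz⟩

/-! ### The Euclidean cosine law -/

/-- The cosine of the angle facing the side `a` of a Euclidean triangle. -/
def euclideanCos (a b c : ℝ) : ℝ := (b ^ 2 + c ^ 2 - a ^ 2) / (2 * b * c)

/-- The differential of `euclideanCos`. -/
def euclideanCosDeriv (a b c a' b' c' : ℝ) : ℝ :=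
  -a / (b * c) * a' + (a ^ 2 + b ^ 2 - c ^ 2) / (2 * b ^ 2 * c) * b' +
    (a ^ 2 + c ^ 2 - b ^ 2) / (2 * b * c ^ 2) * c'

/-- The squared ratio between the sines of the angles of a Euclidean triangle and its side
lengths. -/
def euclideanDisc (l : Fin 3 → ℝ) : ℝ :=
  (2 * (l 0 ^ 2 * l 1 ^ 2 + l 1 ^ 2 * l 2 ^ 2 + l 2 ^ 2 * l 0 ^ 2) - l 0 ^ 4 - l 1 ^ 4 - l 2 ^ 4) /
    (4 * l 0 ^ 2 * l 1 ^ 2 * l 2 ^ 2)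

/-- Only two squares occur: the form must degenerate along `v = l`, since angles are invariant under
scaling. -/
theorem lawForm_euclidean {l : Fin 3 → ℝ} (hl : ∀ i, 0 < l i) (v : Fin 3 → ℝ) :
    lawForm id euclideanCosDeriv l v =
      ((v 0 - euclideanCos (l 2) (l 0) (l 1) * v 1 - euclideanCos (l 1) (l 2) (l 0) * v 2) ^ 2 +
      euclideanDisc l * (l 2 * v 1 - l 1 * v 2) ^ 2) / (l 0 * l 1 * l 2) := by
  have h0 := (hl 0).ne'
  have h1 := (hl 1).ne'
  have h2 := (hl 2).ne'
  simp only [lawForm, Fin.sum_univ_three, euclideanCosDeriv, euclideanCos, euclideanDisc, id,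
    Fin.isValue, zero_add, show (1 : Fin 3) + 1 = 2 from rfl, show (1 : Fin 3) + 2 = 0 from rfl,
    show (2 : Fin 3) + 1 = 0 from rfl, show (2 : Fin 3) + 2 = 1 from rfl]
  field_simp
  ring

theorem euclidean_cosineLaw :
    CosineLaw (Ioi 0) id euclideanCos euclideanCosDeriv euclideanDisc where
  isOpen := isOpen_Ioi
  ordConnected := ordConnected_Ioi
  pos x hx := hx
  continuousOn := continuousOn_id
  one_sub_sq l hl i := by
    have h0 : l 0 ≠ 0 := ne_of_gt (hl 0)
    have h1 : l 1 ≠ 0 := ne_of_gt (hl 1)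
    have h2 : l 2 ≠ 0 := ne_of_gt (hl 2)
    fin_cases i
    · change 1 - euclideanCos (l 0) (l 1) (l 2) ^ 2 = l 0 ^ 2 * euclideanDisc l
      simp only [euclideanCos, euclideanDisc]
      field_simp
      ring
    · change 1 - euclideanCos (l 1) (l 2) (l 0) ^ 2 = l 1 ^ 2 * euclideanDisc l
      simp only [euclideanCos, euclideanDisc]
      field_simp
      ring
    · change 1 - euclideanCos (l 2) (l 0) (l 1) ^ 2 = l 2 ^ 2 * euclideanDisc l
      simp only [euclideanCos, euclideanDisc]
      field_simp
      ring
  hasDerivAt a b c a' b' c' t ha hb hc hda hdb hdc := by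
    have hb0 : b t ≠ 0 := ne_of_gt hb
    have hc0 : c t ≠ 0 := ne_of_gt hc
    refine ((((hdb.pow 2).add (hdc.pow 2)).sub (hda.pow 2)).div ((hdb.const_mul 2).mul hdc)
      (by simp [hb0, hc0])).congr_deriv ?_
    simp only [euclideanCosDeriv, Pi.mul_apply, Pi.pow_apply, Pi.add_apply, Pi.sub_apply]
    field_simp
    ring
  form_nonneg l v hl hR := by
    rw [lawForm_euclidean hl]
    have h0 : 0 < l 0 := hl 0
    have h1 : 0 < l 1 := hl 1
    have h2 : 0 < l 2 := hl 2
    positivity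

/-! ### The spherical cosine law -/

/-- The cosine of the angle facing the side `a` of a spherical triangle. -/
def sphericalCos (a b c : ℝ) : ℝ :=
  (Real.cos a - Real.cos b * Real.cos c) / (Real.sin b * Real.sin c)

/-- The differential of `sphericalCos`. -/
def sphericalCosDeriv (a b c a' b' c' : ℝ) : ℝ :=
  -Real.sin a / (Real.sin b * Real.sin c) * a' +
    (Real.cos c - Real.cos a * Real.cos b) / (Real.sin b ^ 2 * Real.sin c) * b' +
    (Real.cos b - Real.cos a * Real.cos c) / (Real.sin b * Real.sin c ^ 2) * c'

/-- The squared ratio in the sine law for spherical triangles. -/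
def sphericalDisc (l : Fin 3 → ℝ) : ℝ :=
  (1 + 2 * Real.cos (l 0) * Real.cos (l 1) * Real.cos (l 2) - Real.cos (l 0) ^ 2 -
    Real.cos (l 1) ^ 2 - Real.cos (l 2) ^ 2) /
    (Real.sin (l 0) ^ 2 * Real.sin (l 1) ^ 2 * Real.sin (l 2) ^ 2)

/-- Up to a positive factor the matrix has unit diagonal and the negated cosines of the angles off
the diagonal. By the sine law its minors are squares of sines times powers of `sphericalDisc`. -/
theorem lawForm_spherical_pos {l v : Fin 3 → ℝ} (hl : ∀ i, l i ∈ Ioo 0 π)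
    (hR : 0 < sphericalDisc l) (hv : v ≠ 0) : 0 < lawForm Real.sin sphericalCosDeriv l v := by
  have h0 := Real.sin_pos_of_mem_Ioo (hl 0)
  have h1 := Real.sin_pos_of_mem_Ioo (hl 1)
  have h2 := Real.sin_pos_of_mem_Ioo (hl 2)
  have e0 := Real.sin_sq (l 0)
  have e1 := Real.sin_sq (l 1)
  have e2 := Real.sin_sq (l 2)
  have hD : 0 < 1 + 2 * Real.cos (l 0) * Real.cos (l 1) * Real.cos (l 2) - Real.cos (l 0) ^ 2 -
      Real.cos (l 1) ^ 2 - Real.cos (l 2) ^ 2 := by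
    rw [sphericalDisc] at hR
    exact (div_pos_iff_of_pos_right (by positivity)).1 hR
  have hv' : ¬(v 0 = 0 ∧ v 1 = 0 ∧ v 2 = 0) := fun h => hv (by
    ext i; fin_cases i <;> simp [h])
  have key : lawForm Real.sin sphericalCosDeriv l v =
      (1 * v 0 ^ 2 + 1 * v 1 ^ 2 + 1 * v 2 ^ 2 +
      2 * (-sphericalCos (l 0) (l 1) (l 2)) * v 1 * v 2 +
      2 * (-sphericalCos (l 1) (l 2) (l 0)) * v 0 * v 2 +
      2 * (-sphericalCos (l 2) (l 0) (l 1)) * v 0 * v 1) /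
      (Real.sin (l 0) * Real.sin (l 1) * Real.sin (l 2)) := by
    simp only [lawForm, Fin.sum_univ_three, sphericalCosDeriv, sphericalCos,
      Fin.isValue, zero_add, show (1 : Fin 3) + 1 = 2 from rfl, show (1 : Fin 3) + 2 = 0 from rfl,
      show (2 : Fin 3) + 1 = 0 from rfl, show (2 : Fin 3) + 2 = 1 from rfl]
    field_simp
    ring
  rw [key]
  refine div_pos (ternary_form_pos one_pos ?_ ?_ hv') (by positivity)
  · have : 1 * 1 - (-sphericalCos (l 2) (l 0) (l 1)) ^ 2 =
      Real.sin (l 2) ^ 2 * sphericalDisc l := by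
      simp only [sphericalCos, sphericalDisc]
      field_simp
      rw [e0, e1]; ring
    rw [this]
    positivity
  · have : 1 * 1 * 1 + 2 * (-sphericalCos (l 0) (l 1) (l 2)) * (-sphericalCos (l 1) (l 2) (l 0)) *
        (-sphericalCos (l 2) (l 0) (l 1)) - 1 * (-sphericalCos (l 0) (l 1) (l 2)) ^ 2 -
        1 * (-sphericalCos (l 1) (l 2) (l 0)) ^ 2 - 1 * (-sphericalCos (l 2) (l 0) (l 1)) ^ 2 =
        sphericalDisc l ^ 2 * (Real.sin (l 0) * Real.sin (l 1) * Real.sin (l 2)) ^ 2 := by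
      simp only [sphericalCos, sphericalDisc]
      field_simp
      simp only [e0, e1, e2]; ring
    rw [this]
    positivity

theorem spherical_cosineLaw :
    CosineLaw (Ioo 0 π) Real.sin sphericalCos sphericalCosDeriv sphericalDisc where
  isOpen := isOpen_Ioo
  ordConnected := ordConnected_Ioo
  pos x hx := Real.sin_pos_of_mem_Ioo hx
  continuousOn := Real.continuous_sin.continuousOn
  one_sub_sq l hl i := by
    have h0 := (Real.sin_pos_of_mem_Ioo (hl 0)).ne'
    have h1 := (Real.sin_pos_of_mem_Ioo (hl 1)).ne'
    have h2 := (Real.sin_pos_of_mem_Ioo (hl 2)).ne'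
    fin_cases i
    · change 1 - sphericalCos (l 0) (l 1) (l 2) ^ 2 = Real.sin (l 0) ^ 2 * sphericalDisc l
      simp only [sphericalCos, sphericalDisc]
      field_simp
      simp only [Real.sin_sq]
      ring
    · change 1 - sphericalCos (l 1) (l 2) (l 0) ^ 2 = Real.sin (l 1) ^ 2 * sphericalDisc l
      simp only [sphericalCos, sphericalDisc]
      field_simp
      simp only [Real.sin_sq]
      ring
    · change 1 - sphericalCos (l 2) (l 0) (l 1) ^ 2 = Real.sin (l 2) ^ 2 * sphericalDisc l
      simp only [sphericalCos, sphericalDisc]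
      field_simp
      simp only [Real.sin_sq]
      ring
  hasDerivAt a b c a' b' c' t ha hb hc hda hdb hdc := by
    have hb0 := (Real.sin_pos_of_mem_Ioo hb).ne'
    have hc0 := (Real.sin_pos_of_mem_Ioo hc).ne'
    refine ((hda.cos.sub (hdb.cos.mul hdc.cos)).div (hdb.sin.mul hdc.sin)
      (by simp [hb0, hc0])).congr_deriv ?_
    simp only [sphericalCosDeriv, Pi.mul_apply, Pi.sub_apply]
    field_simp
    linear_combination (Real.sin (b t) * Real.cos (b t) * c') * Real.sin_sq_add_cos_sq (c t) +
      (Real.sin (c t) * Real.cos (c t) * b') * Real.sin_sq_add_cos_sq (b t)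
  form_nonneg l v hl hR := by
    rcases eq_or_ne v 0 with rfl | hv
    · simp [lawForm]
    · exact (lawForm_spherical_pos hl hR hv).le

/-! ### The cosine law for the deviations of hyperbolic triangles -/

/-- The sine of half of `β + γ - α`, where `α` is the angle facing the side `a` of a hyperbolic
triangle and `β`, `γ` are the other two angles. -/
def hyperbolicCos (a b c : ℝ) : ℝ :=
  (Real.sinh (b / 2) ^ 2 + Real.sinh (c / 2) ^ 2 - Real.sinh (a / 2) ^ 2) /
    (2 * Real.cosh (a / 2) * Real.sinh (b / 2) * Real.sinh (c / 2))

/-- The differential of `hyperbolicCos`. -/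
def hyperbolicCosDeriv (a b c a' b' c' : ℝ) : ℝ :=
  -(Real.sinh (a / 2) *
    (Real.sinh (a / 2) ^ 2 + Real.sinh (b / 2) ^ 2 + Real.sinh (c / 2) ^ 2 + 2)) /
    (4 * Real.cosh (a / 2) ^ 2 * Real.sinh (b / 2) * Real.sinh (c / 2)) * a' +
  Real.cosh (b / 2) * (Real.sinh (a / 2) ^ 2 + Real.sinh (b / 2) ^ 2 - Real.sinh (c / 2) ^ 2) /
    (4 * Real.cosh (a / 2) * Real.sinh (b / 2) ^ 2 * Real.sinh (c / 2)) * b' +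
  Real.cosh (c / 2) * (Real.sinh (a / 2) ^ 2 + Real.sinh (c / 2) ^ 2 - Real.sinh (b / 2) ^ 2) /
    (4 * Real.cosh (a / 2) * Real.sinh (b / 2) * Real.sinh (c / 2) ^ 2) * c'

/-- The squared ratio between `cos ((β + γ - α) / 2)` and `tanh (a / 2)` in a hyperbolic
triangle. -/
def hyperbolicDisc (l : Fin 3 → ℝ) : ℝ :=
  (2 * (Real.sinh (l 0 / 2) ^ 2 * Real.sinh (l 1 / 2) ^ 2 +
    Real.sinh (l 1 / 2) ^ 2 * Real.sinh (l 2 / 2) ^ 2 +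
    Real.sinh (l 2 / 2) ^ 2 * Real.sinh (l 0 / 2) ^ 2) -
    Real.sinh (l 0 / 2) ^ 4 - Real.sinh (l 1 / 2) ^ 4 - Real.sinh (l 2 / 2) ^ 4 +
    4 * Real.sinh (l 0 / 2) ^ 2 * Real.sinh (l 1 / 2) ^ 2 * Real.sinh (l 2 / 2) ^ 2) /
  (4 * Real.sinh (l 0 / 2) ^ 2 * Real.sinh (l 1 / 2) ^ 2 * Real.sinh (l 2 / 2) ^ 2)

theorem sinh_half_pos {x : ℝ} (hx : 0 < x) : 0 < Real.sinh (x / 2) :=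
  Real.sinh_pos_iff.2 (half_pos hx)

/-- In terms of `x`, `y`, `z`, the hyperbolic sines of the half lengths, clearing the factor `4 * x
* y * z` leaves a matrix with constant diagonal `W`. Its second and third minors are positive
multiples of `D` and `D ^ 2`, where `D` is the numerator of `hyperbolicDisc`. -/
theorem lawForm_hyperbolic_pos {l v : Fin 3 → ℝ} (hl : ∀ i, l i ∈ Ioi 0)
    (hR : 0 < hyperbolicDisc l) (hv : v ≠ 0) :
    0 < lawForm (fun x => Real.tanh (x / 2)) hyperbolicCosDeriv l v := by
  have h0 : 0 < Real.sinh (l 0 / 2) := sinh_half_pos (hl 0)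
  have h1 : 0 < Real.sinh (l 1 / 2) := sinh_half_pos (hl 1)
  have h2 : 0 < Real.sinh (l 2 / 2) := sinh_half_pos (hl 2)
  have c0 := Real.cosh_pos (l 0 / 2)
  have c1 := Real.cosh_pos (l 1 / 2)
  have c2 := Real.cosh_pos (l 2 / 2)
  have e0 := Real.cosh_sq (l 0 / 2)
  have e1 := Real.cosh_sq (l 1 / 2)
  have e2 := Real.cosh_sq (l 2 / 2)
  have hv' : ¬(v 0 = 0 ∧ v 1 = 0 ∧ v 2 = 0) := fun h => hv (by
    ext i; fin_cases i <;> simp [h])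
  simp only [lawForm, Fin.sum_univ_three, hyperbolicCosDeriv, hyperbolicDisc,
      Fin.isValue, zero_add, show (1 : Fin 3) + 1 = 2 from rfl, show (1 : Fin 3) + 2 = 0 from rfl,
      show (2 : Fin 3) + 1 = 0 from rfl, show (2 : Fin 3) + 2 = 1 from rfl,
      Real.tanh_eq_sinh_div_cosh] at hR ⊢
  set x := Real.sinh (l 0 / 2)
  set y := Real.sinh (l 1 / 2)
  set z := Real.sinh (l 2 / 2)
  set p := Real.cosh (l 0 / 2)
  set q := Real.cosh (l 1 / 2)
  set r := Real.cosh (l 2 / 2)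
  have hD := (div_pos_iff_of_pos_right (by positivity)).1 hR
  set D := 2 * (x ^ 2 * y ^ 2 + y ^ 2 * z ^ 2 + z ^ 2 * x ^ 2) - x ^ 4 - y ^ 4 - z ^ 4 +
    4 * x ^ 2 * y ^ 2 * z ^ 2 with hDdef
  set W := x ^ 2 + y ^ 2 + z ^ 2 + 2 with hW
  have key := ternary_form_pos (p := W) (q := W) (r := W)
    (a := -((y ^ 2 + z ^ 2 - x ^ 2) * (q * r) / (y * z)))
    (b := -((x ^ 2 + z ^ 2 - y ^ 2) * (p * r) / (x * z)))
    (c := -((x ^ 2 + y ^ 2 - z ^ 2) * (p * q) / (x * y))) (by positivity) ?_ ?_ hv'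
  · have h4 : 0 < 4 * (x * y * z) := by positivity
    refine (div_pos key h4).trans_eq ?_
    field_simp
    ring
  · have : W * W - (-((x ^ 2 + y ^ 2 - z ^ 2) * (p * q) / (x * y))) ^ 2 =
      D * (x ^ 2 + y ^ 2 + 1) / (x ^ 2 * y ^ 2) := by
      field_simp
      rw [e0, e1, hDdef, hW]
      ring
    rw [this]
    positivity
  · have : W * W * W + 2 * (-((y ^ 2 + z ^ 2 - x ^ 2) * (q * r) / (y * z))) *
        (-((x ^ 2 + z ^ 2 - y ^ 2) * (p * r) / (x * z))) *
        (-((x ^ 2 + y ^ 2 - z ^ 2) * (p * q) / (x * y))) -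
        W * (-((y ^ 2 + z ^ 2 - x ^ 2) * (q * r) / (y * z))) ^ 2 -
        W * (-((x ^ 2 + z ^ 2 - y ^ 2) * (p * r) / (x * z))) ^ 2 -
        W * (-((x ^ 2 + y ^ 2 - z ^ 2) * (p * q) / (x * y))) ^ 2 = D ^ 2 / (x * y * z) ^ 2 := by
      field_simp
      rw [e0, e1, e2, hDdef, hW]
      ring
    rw [this]
    positivity

theorem hyperbolic_cosineLaw :
    CosineLaw (Ioi 0) (fun x => Real.tanh (x / 2)) hyperbolicCos hyperbolicCosDeriv
      hyperbolicDisc where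
  isOpen := isOpen_Ioi
  ordConnected := ordConnected_Ioi
  pos x hx := by
    rw [Real.tanh_eq_sinh_div_cosh]
    exact div_pos (sinh_half_pos hx) (Real.cosh_pos _)
  continuousOn := by
    simp only [Real.tanh_eq_sinh_div_cosh]
    refine Continuous.continuousOn (Continuous.div (by fun_prop) (by fun_prop) fun x => ?_)
    exact (Real.cosh_pos _).ne'
  one_sub_sq l hl i := by
    have h0 := (sinh_half_pos (hl 0)).ne'
    have h1 := (sinh_half_pos (hl 1)).ne'
    have h2 := (sinh_half_pos (hl 2)).ne'
    have c0 := (Real.cosh_pos (l 0 / 2)).ne'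
    have c1 := (Real.cosh_pos (l 1 / 2)).ne'
    have c2 := (Real.cosh_pos (l 2 / 2)).ne'
    fin_cases i
    · change 1 - hyperbolicCos (l 0) (l 1) (l 2) ^ 2 = Real.tanh (l 0 / 2) ^ 2 * hyperbolicDisc l
      simp only [hyperbolicCos, hyperbolicDisc, Real.tanh_eq_sinh_div_cosh]
      field_simp
      simp only [Real.cosh_sq]
      ring
    · change 1 - hyperbolicCos (l 1) (l 2) (l 0) ^ 2 = Real.tanh (l 1 / 2) ^ 2 * hyperbolicDisc l
      simp only [hyperbolicCos, hyperbolicDisc, Real.tanh_eq_sinh_div_cosh]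
      field_simp
      simp only [Real.cosh_sq]
      ring
    · change 1 - hyperbolicCos (l 2) (l 0) (l 1) ^ 2 = Real.tanh (l 2 / 2) ^ 2 * hyperbolicDisc l
      simp only [hyperbolicCos, hyperbolicDisc, Real.tanh_eq_sinh_div_cosh]
      field_simp
      simp only [Real.cosh_sq]
      ring
  hasDerivAt a b c a' b' c' t ha hb hc hda hdb hdc := by
    have ha0 := (Real.cosh_pos (a t / 2)).ne'
    have hb0 := (sinh_half_pos hb).ne'
    have hc0 := (sinh_half_pos hc).ne'
    have hda' := hda.div_const 2
    have hdb' := hdb.div_const 2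
    have hdc' := hdc.div_const 2
    refine ((((hdb'.sinh.pow 2).add (hdc'.sinh.pow 2)).sub (hda'.sinh.pow 2)).div
      (((hda'.cosh.const_mul 2).mul hdb'.sinh).mul hdc'.sinh)
      (by simp [ha0, hb0, hc0])).congr_deriv ?_
    simp only [hyperbolicCosDeriv, Pi.mul_apply, Pi.pow_apply, Pi.add_apply, Pi.sub_apply]
    field_simp
    simp only [Nat.cast_ofNat, Nat.reduceSub, pow_one]
    linear_combination (-8 * Real.sinh (a t / 2) * Real.sinh (b t / 2) *
      Real.sinh (c t / 2) * a') * Real.cosh_sq (a t / 2)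
  form_nonneg l v hl hR := by
    rcases eq_or_ne v 0 with rfl | hv
    · simp [lawForm]
    · exact (lawForm_hyperbolic_pos hl hR hv).le

/-! ### Triangle inequalities -/

/-- The strict triangle inequalities. -/
def TriangleIneq (l : Fin 3 → ℝ) : Prop := ∀ i, l i < l (i + 1) + l (i + 2)

theorem TriangleIneq.pos {l : Fin 3 → ℝ} (hl : TriangleIneq l) (i : Fin 3) : 0 < l i := by
  have h0 : l 0 < l 1 + l 2 := hl 0
  have h1 : l 1 < l 2 + l 0 := hl 1
  have h2 : l 2 < l 0 + l 1 := hl 2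
  fin_cases i
  · change 0 < l 0; linarith
  · change 0 < l 1; linarith
  · change 0 < l 2; linarith

/-- The numerator is the product in Heron's formula. -/
theorem euclideanDisc_pos {l : Fin 3 → ℝ} (hl : TriangleIneq l) : 0 < euclideanDisc l := by
  have p0 := hl.pos 0
  have p1 := hl.pos 1
  have p2 := hl.pos 2
  have h0 : 0 < l 1 + l 2 - l 0 := sub_pos.2 (hl 0)
  have h1 : 0 < l 2 + l 0 - l 1 := sub_pos.2 (hl 1)
  have h2 : 0 < l 0 + l 1 - l 2 := sub_pos.2 (hl 2)
  refine div_pos ?_ (by positivity)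
  have : 0 < (l 0 + l 1 + l 2) * (l 1 + l 2 - l 0) * (l 2 + l 0 - l 1) * (l 0 + l 1 - l 2) := by
    positivity
  nlinarith [this]

theorem sinh_half_sq (x : ℝ) : Real.sinh (x / 2) ^ 2 = (Real.cosh x - 1) / 2 := by
  have h1 := Real.cosh_two_mul (x / 2)
  have h2 := Real.cosh_sq (x / 2)
  rw [show 2 * (x / 2) = x by ring] at h1
  linarith

/-- The numerator is a quarter of `(cosh (l 0 + l 1) - cosh (l 2)) * (cosh (l 2) - cosh (l 0 - l
1))`, whose factors are positive by the triangle inequalities. -/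
theorem hyperbolicDisc_pos {l : Fin 3 → ℝ} (hl : TriangleIneq l) : 0 < hyperbolicDisc l := by
  have p0 := sinh_half_pos (hl.pos 0)
  have p1 := sinh_half_pos (hl.pos 1)
  have p2 := sinh_half_pos (hl.pos 2)
  have h0 : l 0 < l 1 + l 2 := hl 0
  have h1 : l 1 < l 2 + l 0 := hl 1
  have h2 : l 2 < l 0 + l 1 := hl 2
  have hlt1 : Real.cosh (l 2) < Real.cosh (l 0 + l 1) := by
    rw [Real.cosh_lt_cosh, abs_of_pos (hl.pos 2), abs_of_pos (add_pos (hl.pos 0) (hl.pos 1))]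
    exact h2
  have hlt2 : Real.cosh (l 0 - l 1) < Real.cosh (l 2) := by
    rw [Real.cosh_lt_cosh, abs_of_pos (hl.pos 2), abs_lt]
    constructor <;> linarith
  refine div_pos ?_ (by positivity)
  have key := mul_pos (sub_pos.2 hlt1) (sub_pos.2 hlt2)
  rw [Real.cosh_add, Real.cosh_sub] at key
  have e0 := Real.sinh_sq (l 0)
  have e1 := Real.sinh_sq (l 1)
  have e4 : ∀ x : ℝ, Real.sinh (x / 2) ^ 4 = ((Real.cosh x - 1) / 2) ^ 2 := fun x => by
    rw [← sinh_half_sq]; ring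
  simp only [sinh_half_sq, e4]
  have e : (Real.sinh (l 0) * Real.sinh (l 1)) ^ 2 =
      (Real.cosh (l 0) ^ 2 - 1) * (Real.cosh (l 1) ^ 2 - 1) := by
    rw [mul_pow, e0, e1]
  linarith

/-! ### Persistence of the triangle inequalities along paths -/

theorem add_sq_div_add_le {p q x y : ℝ} (hx : 0 < x) (hy : 0 < y) :
    (p + q) ^ 2 / (x + y) ≤ p ^ 2 / x + q ^ 2 / y := by
  rw [← sub_nonneg]
  have : p ^ 2 / x + q ^ 2 / y - (p + q) ^ 2 / (x + y) =
      (p * y - q * x) ^ 2 / (x * y * (x + y)) := by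
    field_simp
    ring
  rw [this]
  positivity

/-- In the coordinate `U` the side `i` moves linearly, so it suffices that `G t = U (g t m + g t n)
- t * δ i` is concave: it is positive at both ends. With `k = f / f'`, the velocities satisfy `v' =
(h + 1) * v ^ 2 / k`, and for `h ≤ -1` the sign of `G''` reduces to `(v m + v n) ^ 2 / k (x + y) ≤ v
m ^ 2 / k x + v n ^ 2 / k y`. This follows from superadditivity of `k` and the Cauchy-Schwarz
inequality. The function `k` is the identity in the Euclidean case and `sinh` in the hyperbolic one.
-/
theorem LawPath.lt_add {f k : ℝ → ℝ} {h : ℝ} {δ : Fin 3 → ℝ} {g : ℝ → Fin 3 → ℝ}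
    (hpos : ∀ x ∈ Ioi 0, 0 < f x) (hk : ∀ x ∈ Ioi 0, 0 < k x)
    (hadd : ∀ x ∈ Ioi 0, ∀ y ∈ Ioi 0, k x + k y ≤ k (x + y))
    (hf : ∀ x ∈ Ioi 0, HasDerivAt f (f x / k x) x) (hh : h ≤ -1) (hg : LawPath (Ioi 0) f h δ g)
    (hint : ∀ t ∈ Icc (0 : ℝ) 1, ∀ i, ∫ s in (g 0 i)..(g t i), f s ^ (-h - 1) = t * δ i)
    {i m n : Fin 3} (h0 : g 0 i < g 0 m + g 0 n) (h1 : g 1 i < g 1 m + g 1 n) {t : ℝ}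
    (ht : t ∈ Icc (0 : ℝ) 1) : g t i < g t m + g t n := by
  have hfc : ContinuousOn f (Ioi 0) := fun x hx => (hf x hx).continuousAt.continuousWithinAt
  have hw : ContinuousOn (fun x => f x ^ (-h - 1)) (Ioi 0) :=
    hfc.rpow_const fun x hx => Or.inl (hpos x hx).ne'
  have hwpos : ∀ x ∈ Ioi 0, 0 < f x ^ (-h - 1) := fun x hx => Real.rpow_pos_of_pos (hpos x hx) _
  have z0 : (0 : ℝ) ∈ Icc (0 : ℝ) 1 := ⟨le_rfl, zero_le_one⟩
  have z1 : (1 : ℝ) ∈ Icc (0 : ℝ) 1 := ⟨zero_le_one, le_rfl⟩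
  have hs : ∀ t ∈ Icc (0 : ℝ) 1, g t m + g t n ∈ Ioi (0 : ℝ) := fun t ht =>
    mem_Ioi.2 (add_pos (hg.mem t ht m) (hg.mem t ht n))
  set U : ℝ → ℝ := fun z => ∫ s in (g 0 i)..z, f s ^ (-h - 1) with hU
  have hUd : ∀ z ∈ Ioi 0, HasDerivAt U (f z ^ (-h - 1)) z := fun z hz =>
    hasDerivAt_integral_of_continuousOn isOpen_Ioi ordConnected_Ioi hw (hg.mem 0 z0 i) hz
  have hmono : StrictMonoOn U (Ioi 0) :=
    strictMonoOn_integral ordConnected_Ioi hw hwpos (hg.mem 0 z0 i)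
  have hUg : ∀ t ∈ Icc (0 : ℝ) 1, U (g t i) = t * δ i := fun t ht => hint t ht i
  set v : Fin 3 → ℝ → ℝ := fun j t => δ j * f (g t j) ^ (h + 1) with hv
  have hgv : ∀ j, ∀ t ∈ Icc (0 : ℝ) 1, HasDerivAt (fun s => g s j) (v j t) t := fun j t ht =>
    hg.hasDerivAt t ht j
  have hv' : ∀ j, ∀ t ∈ Icc (0 : ℝ) 1,
      HasDerivAt (v j) ((h + 1) * (v j t ^ 2 / k (g t j))) t := fun j t ht => by
    have hfp := hpos _ (hg.mem t ht j)
    have hkp := (hk _ (hg.mem t ht j)).ne'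
    have h1 : HasDerivAt (fun s => f (g s j)) (f (g t j) / k (g t j) * v j t) t :=
      (hf _ (hg.mem t ht j)).comp t (hgv j t ht)
    refine ((h1.rpow_const (p := h + 1) (Or.inl hfp.ne')).const_mul (δ j)).congr_deriv ?_
    simp only [hv, add_sub_cancel_right]
    rw [Real.rpow_add_one hfp.ne']
    field_simp
  have hsd : ∀ t ∈ Icc (0 : ℝ) 1, HasDerivAt (fun s => g s m + g s n) (v m t + v n t) t :=
    fun t ht => (hgv m t ht).add (hgv n t ht)
  set G : ℝ → ℝ := fun t => U (g t m + g t n) - t * δ i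
  have hG : ∀ t ∈ Icc (0 : ℝ) 1,
      HasDerivAt G (f (g t m + g t n) ^ (-h - 1) * (v m t + v n t) - δ i) t := fun t ht => by
    have h1 := HasDerivAt.comp (h₂ := U) t (hUd _ (hs t ht)) (hsd t ht)
    have h2 : HasDerivAt (fun s => s * δ i) (δ i) t := by
      simpa using (hasDerivAt_id t).mul_const (δ i)
    exact h1.sub h2
  have hG' : ∀ t ∈ Icc (0 : ℝ) 1,
      HasDerivAt (fun t => f (g t m + g t n) ^ (-h - 1) * (v m t + v n t) - δ i)
        (f (g t m + g t n) ^ (-h - 1) * (-h - 1) * ((v m t + v n t) ^ 2 / k (g t m + g t n) -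
          (v m t ^ 2 / k (g t m) + v n t ^ 2 / k (g t n)))) t := fun t ht => by
    have hfp := hpos _ (hs t ht)
    have h1 : HasDerivAt (fun s => f (g s m + g s n))
        (f (g t m + g t n) / k (g t m + g t n) * (v m t + v n t)) t :=
      HasDerivAt.comp (h₂ := f) t (hf _ (hs t ht)) (hsd t ht)
    have h2 := h1.rpow_const (p := -h - 1) (Or.inl hfp.ne')
    refine ((h2.mul ((hv' m t ht).add (hv' n t ht))).sub_const (δ i)).congr_deriv ?_
    simp only [Pi.add_apply]
    rw [Real.rpow_sub_one hfp.ne' (-h - 1)]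
    field_simp
    ring
  have hconc : ConcaveOn ℝ (Icc 0 1) G := by
    refine concaveOn_of_hasDerivWithinAt2_nonpos (convex_Icc 0 1)
      (fun t ht => (hG t ht).continuousAt.continuousWithinAt)
      (fun t ht => (hG t (interior_subset ht)).hasDerivWithinAt)
      (fun t ht => (hG' t (interior_subset ht)).hasDerivWithinAt) fun t ht => ?_
    have ht := interior_subset ht
    refine mul_nonpos_of_nonneg_of_nonpos
      (mul_nonneg (hwpos _ (hs t ht)).le (by linarith)) (sub_nonpos.2 ?_)
    have hm := hk _ (hg.mem t ht m)
    have hn := hk _ (hg.mem t ht n)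
    refine le_trans ?_ (add_sq_div_add_le hm hn)
    exact div_le_div_of_nonneg_left (sq_nonneg _) (add_pos hm hn)
      (hadd _ (hg.mem t ht m) _ (hg.mem t ht n))
  have hG0 : 0 < G 0 := by
    have := hmono (hg.mem 0 z0 i) (hs 0 z0) h0
    rw [hUg 0 z0] at this
    simpa only [G, sub_pos] using this
  have hG1 : 0 < G 1 := by
    have := hmono (hg.mem 1 z1 i) (hs 1 z1) h1
    rw [hUg 1 z1] at this
    simpa only [G, sub_pos] using this
  have hGt : 0 < G t := by
    have := hconc.2 z0 z1 (sub_nonneg.2 ht.2) ht.1 (sub_add_cancel 1 t)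
    simp only [smul_eq_mul, mul_zero, mul_one, zero_add] at this
    refine lt_of_lt_of_le ?_ this
    rcases ht.1.eq_or_lt with rfl | htpos
    · simpa using hG0
    · exact add_pos_of_nonneg_of_pos (mul_nonneg (sub_nonneg.2 ht.2) hG0.le) (mul_pos htpos hG1)
  refine (hmono.lt_iff_lt (hg.mem t ht i) (hs t ht)).1 ?_
  rw [hUg t ht]
  exact sub_pos.1 hGt

theorem triangleIneq_of_path {f k : ℝ → ℝ} {h : ℝ} {δ : Fin 3 → ℝ} {g : ℝ → Fin 3 → ℝ}
    (hpos : ∀ x ∈ Ioi 0, 0 < f x) (hk : ∀ x ∈ Ioi 0, 0 < k x)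
    (hadd : ∀ x ∈ Ioi 0, ∀ y ∈ Ioi 0, k x + k y ≤ k (x + y))
    (hf : ∀ x ∈ Ioi 0, HasDerivAt f (f x / k x) x) (hh : h ≤ -1) (hg : LawPath (Ioi 0) f h δ g)
    (hint : ∀ t ∈ Icc (0 : ℝ) 1, ∀ i, ∫ s in (g 0 i)..(g t i), f s ^ (-h - 1) = t * δ i)
    (h0 : TriangleIneq (g 0)) (h1 : TriangleIneq (g 1)) {t : ℝ} (ht : t ∈ Icc (0 : ℝ) 1) :
    TriangleIneq (g t) := fun i =>
  hg.lt_add hpos hk hadd hf hh hint (h0 i) (h1 i) ht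

theorem sinh_add_sinh_le {x y : ℝ} (hx : 0 ≤ x) (hy : 0 ≤ y) :
    Real.sinh x + Real.sinh y ≤ Real.sinh (x + y) := by
  rw [Real.sinh_add]
  exact add_le_add (le_mul_of_one_le_right (Real.sinh_nonneg_iff.2 hx) (Real.one_le_cosh y))
    (le_mul_of_one_le_left (Real.sinh_nonneg_iff.2 hy) (Real.one_le_cosh x))

theorem hasDerivAt_tanh_half {x : ℝ} (hx : 0 < x) :
    HasDerivAt (fun z => Real.tanh (z / 2)) (Real.tanh (x / 2) / Real.sinh x) x := by
  have hc := (Real.cosh_pos (x / 2)).ne'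
  have hs := (sinh_half_pos hx).ne'
  have h1 : HasDerivAt (fun z : ℝ => z / 2) (1 / 2) x := (hasDerivAt_id x).div_const 2
  have h2 := h1.sinh.div h1.cosh hc
  simp only [Real.tanh_eq_sinh_div_cosh]
  refine h2.congr_deriv ?_
  have h3 : Real.sinh x = 2 * Real.sinh (x / 2) * Real.cosh (x / 2) := by
    rw [← Real.sinh_two_mul]; ring_nf
  rw [h3]
  field_simp
  rw [Real.cosh_sq]
  ring

/-! ### Monotonicity for a single triangle -/

theorem eq_of_integral_eq_zero {I : Set ℝ} {w : ℝ → ℝ} (hI : I.OrdConnected)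
    (hw : ContinuousOn w I) (hpos : ∀ x ∈ I, 0 < w x) {x y : ℝ} (hx : x ∈ I) (hy : y ∈ I)
    (h : ∫ t in x..y, w t = 0) : x = y := by
  refine (strictMonoOn_integral hI hw hpos hx).injOn hx hy ?_
  simp only [integral_same, h]

/-- The substitution `s = x * σ` shows that the rescaled coordinate difference depends only on `y /
x`; this is how a kernel vector is recognized as a common scaling factor. -/
theorem integral_rpow_eq_of_pos (r : ℝ) {x y : ℝ} (hx : 0 < x) (hy : 0 < y) :
    (∫ s in x..y, s ^ (-r - 1)) * x ^ r = ∫ s in (1 : ℝ)..(y / x), s ^ (-r - 1) := by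
  have h1 := integral_comp_mul_left (a := 1) (b := y / x) (fun s : ℝ => s ^ (-r - 1)) hx.ne'
  rw [mul_one, mul_div_cancel₀ _ hx.ne'] at h1
  have h2 : ∫ s in (1 : ℝ)..(y / x), (x * s) ^ (-r - 1) =
      ∫ s in (1 : ℝ)..(y / x), x ^ (-r - 1) * s ^ (-r - 1) := by
    refine integral_congr fun s hs => ?_
    have hs0 : s ∈ Ioi (0 : ℝ) :=
      ordConnected_Ioi.uIcc_subset (mem_Ioi.2 one_pos) (mem_Ioi.2 (div_pos hy hx)) hs
    exact Real.mul_rpow hx.le hs0.le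
  rw [h2, intervalIntegral.integral_const_mul, smul_eq_mul] at h1
  have h3 : x ^ (-r - 1) * x ^ r = x⁻¹ := by
    rw [← Real.rpow_add hx, ← Real.rpow_neg_one]
    ring_nf
  have h4 : ∫ s in x..y, s ^ (-r - 1) =
      x * (x ^ (-r - 1) * ∫ s in (1 : ℝ)..(y / x), s ^ (-r - 1)) := by
    rw [h1, mul_inv_cancel_left₀ hx.ne']
  rw [h4]
  calc _ = x * (x ^ (-r - 1) * x ^ r) * ∫ s in (1 : ℝ)..(y / x), s ^ (-r - 1) := by ring
    _ = _ := by rw [h3, mul_inv_cancel₀ hx.ne', one_mul]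

/-- Both squares in `lawForm_euclidean` vanish. One makes `v 1` and `v 2` proportional to `l 1` and
`l 2`; the other then determines `v 0`, because `l 0` is the sum of the projections of the other two
sides. -/
theorem eq_smul_of_lawForm_euclidean_eq_zero {l : Fin 3 → ℝ} (hl : ∀ i, 0 < l i)
    (hR : 0 < euclideanDisc l) {v : Fin 3 → ℝ} (hv : lawForm id euclideanCosDeriv l v = 0) :
    ∃ k, ∀ i, v i = k * l i := by
  have h0 := hl 0
  have h1 := hl 1
  have h2 := hl 2
  rw [lawForm_euclidean hl, div_eq_zero_iff, or_iff_left (by positivity)] at hv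
  have hsq := (add_eq_zero_iff_of_nonneg (sq_nonneg _) (mul_nonneg hR.le (sq_nonneg _))).1 hv
  have e1 : v 0 - euclideanCos (l 2) (l 0) (l 1) * v 1 - euclideanCos (l 1) (l 2) (l 0) * v 2 = 0 :=
    pow_eq_zero_iff two_ne_zero |>.1 hsq.1
  have e2 : l 2 * v 1 - l 1 * v 2 = 0 := by
    simpa [hR.ne'] using hsq.2
  have e3 : v 2 = v 1 / l 1 * l 2 := by
    field_simp
    linarith
  refine ⟨v 1 / l 1, fun i => ?_⟩
  fin_cases i
  · change v 0 = v 1 / l 1 * l 0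
    rw [e3] at e1
    have : v 0 = euclideanCos (l 2) (l 0) (l 1) * v 1 +
      euclideanCos (l 1) (l 2) (l 0) * (v 1 / l 1 * l 2) := by linarith
    rw [this, euclideanCos, euclideanCos]
    field_simp
    ring
  · change v 1 = v 1 / l 1 * l 1
    field_simp
  · exact e3

theorem euclidean_monotonicity (h : ℝ) {l l' : Fin 3 → ℝ} (hl : TriangleIneq l)
    (hl' : TriangleIneq l') :
    0 ≤ ∑ i, (sinPowPrimitive h (lawAngle euclideanCos l' i) -
      sinPowPrimitive h (lawAngle euclideanCos l i)) * ∫ s in (l i)..(l' i), s ^ (-h - 1) ∧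
    (∑ i, (sinPowPrimitive h (lawAngle euclideanCos l' i) -
      sinPowPrimitive h (lawAngle euclideanCos l i)) * ∫ s in (l i)..(l' i), s ^ (-h - 1) = 0 →
      ∃ c, 0 < c ∧ ∀ i, l' i = c * l i) := by
  obtain ⟨g, rfl, rfl, hg, hint⟩ := exists_lawPath isOpen_Ioi ordConnected_Ioi
    euclidean_cosineLaw.pos euclidean_cosineLaw.continuousOn h hl.pos hl'.pos
  have hcase : -1 < h ∨ ∀ t ∈ Icc (0 : ℝ) 1, 0 < euclideanDisc (g t) := by
    rcases lt_or_ge (-1) h with hh | hh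
    · exact Or.inl hh
    · refine Or.inr fun t ht => euclideanDisc_pos ?_
      refine triangleIneq_of_path (k := id) (fun x hx => hx) (fun x hx => hx)
        (fun x _ y _ => le_rfl) (fun x hx => ?_) hh hg hint hl hl' ht
      rw [id, div_self (ne_of_gt hx)]
      exact hasDerivAt_id x
  refine (euclidean_cosineLaw.monotonicity_of_path hg hcase (euclideanDisc_pos hl)).imp_right
    fun H heq => ?_
  obtain ⟨k, hk⟩ := eq_smul_of_lawForm_euclidean_eq_zero hl.pos (euclideanDisc_pos hl) (H heq)
  have hk' : ∀ i, ∫ s in (1 : ℝ)..(g 1 i / g 0 i), s ^ (-h - 1) = k := fun i => by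
    have hi := hl.pos i
    have h1 := hk i
    simp only [id] at h1
    rw [Real.rpow_add_one hi.ne', ← mul_assoc] at h1
    rw [← integral_rpow_eq_of_pos h hi (hl'.pos i)]
    exact mul_right_cancel₀ hi.ne' h1
  have hratio : ∀ i, 0 < g 1 i / g 0 i := fun i => div_pos (hl'.pos i) (hl.pos i)
  refine ⟨g 1 0 / g 0 0, hratio 0, fun i => ?_⟩
  have hw : ContinuousOn (fun s : ℝ => s ^ (-h - 1)) (Ioi 0) :=
    continuousOn_id.rpow_const fun x hx => Or.inl (ne_of_gt hx)
  have hinj := (strictMonoOn_integral ordConnected_Ioi hw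
    (fun x hx => Real.rpow_pos_of_pos hx _) (mem_Ioi.2 one_pos)).injOn
  have := hinj (mem_Ioi.2 (hratio i)) (mem_Ioi.2 (hratio 0)) ((hk' i).trans (hk' 0).symm)
  rw [← this, div_mul_cancel₀ _ (hl.pos i).ne']

/-! ### Spherical triangles and their polar triangles -/

theorem sphericalDisc_pos {l : Fin 3 → ℝ} (hl : TriangleIneq l) (hsum : ∑ i, l i < 2 * π) :
    0 < sphericalDisc l := by
  rw [Fin.sum_univ_three] at hsum
  have p0 := hl.pos 0
  have p1 := hl.pos 1
  have p2 := hl.pos 2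
  have h0 : l 0 < l 1 + l 2 := hl 0
  have h1 : l 1 < l 2 + l 0 := hl 1
  have h2 : l 2 < l 0 + l 1 := hl 2
  have s0 := Real.sin_pos_of_pos_of_lt_pi p0 (by linarith)
  have s1 := Real.sin_pos_of_pos_of_lt_pi p1 (by linarith)
  have s2 := Real.sin_pos_of_pos_of_lt_pi p2 (by linarith)
  have hlt1 : Real.cos (l 0 + l 1) < Real.cos (l 2) := by
    rcases le_total (l 0 + l 1) π with hle | hle
    · exact Real.cos_lt_cos_of_nonneg_of_le_pi p2.le hle h2
    -- Beyond `π` the cosine is no longer decreasing; after reflection the perimeter bound takes the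
    -- place of the triangle inequality.
    · rw [← Real.cos_two_pi_sub (l 0 + l 1)]
      exact Real.cos_lt_cos_of_nonneg_of_le_pi p2.le (by linarith) (by linarith)
  have hlt2 : Real.cos (l 2) < Real.cos (l 0 - l 1) := by
    rw [← Real.cos_abs (l 0 - l 1)]
    refine Real.cos_lt_cos_of_nonneg_of_le_pi (abs_nonneg _) (by linarith) ?_
    rw [abs_lt]
    constructor <;> linarith
  refine div_pos ?_ (by positivity)
  have key := mul_pos (sub_pos.2 hlt1) (sub_pos.2 hlt2)
  rw [Real.cos_add, Real.cos_sub] at key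
  have e : (Real.sin (l 0) * Real.sin (l 1)) ^ 2 =
      (1 - Real.cos (l 0) ^ 2) * (1 - Real.cos (l 1) ^ 2) := by
    rw [mul_pow, Real.sin_sq, Real.sin_sq]
  linarith

theorem TriangleIneq.mem_Ioo {l : Fin 3 → ℝ} (hl : TriangleIneq l) (hsum : ∑ i, l i < 2 * π)
    (i : Fin 3) : l i ∈ Ioo 0 π := by
  rw [Fin.sum_univ_three] at hsum
  have h0 : l 0 < l 1 + l 2 := hl 0
  have h1 : l 1 < l 2 + l 0 := hl 1
  have h2 : l 2 < l 0 + l 1 := hl 2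
  refine ⟨hl.pos i, ?_⟩
  fin_cases i
  · change l 0 < π; linarith
  · change l 1 < π; linarith
  · change l 2 < π; linarith

/-- The side lengths of the polar triangle. -/
def polar (l : Fin 3 → ℝ) (i : Fin 3) : ℝ := π - lawAngle sphericalCos l i

theorem polar_mem_Ioo {l : Fin 3 → ℝ} (hl : ∀ i, l i ∈ Ioo 0 π) (hR : 0 < sphericalDisc l)
    (i : Fin 3) : polar l i ∈ Ioo 0 π := by
  have := spherical_cosineLaw.lawAngle_mem_Ioo hl hR i
  exact ⟨by simpa [polar] using this.2, by simpa [polar] using this.1⟩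

theorem sphericalCos_add_mul {l : Fin 3 → ℝ} (hl : ∀ i, l i ∈ Ioo 0 π) (i : Fin 3) :
    sphericalCos (l i) (l (i + 1)) (l (i + 2)) +
      sphericalCos (l (i + 1)) (l (i + 2)) (l i) * sphericalCos (l (i + 2)) (l i) (l (i + 1)) =
    Real.cos (l i) * (Real.sin (l (i + 1)) * Real.sin (l (i + 2)) * sphericalDisc l) := by
  have h0 := (Real.sin_pos_of_mem_Ioo (hl 0)).ne'
  have h1 := (Real.sin_pos_of_mem_Ioo (hl 1)).ne'
  have h2 := (Real.sin_pos_of_mem_Ioo (hl 2)).ne'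
  fin_cases i
  · change sphericalCos (l 0) (l 1) (l 2) +
      sphericalCos (l 1) (l 2) (l 0) * sphericalCos (l 2) (l 0) (l 1) =
      Real.cos (l 0) * (Real.sin (l 1) * Real.sin (l 2) * sphericalDisc l)
    simp only [sphericalCos, sphericalDisc]
    field_simp
    simp only [Real.sin_sq]
    ring
  · change sphericalCos (l 1) (l 2) (l 0) +
      sphericalCos (l 2) (l 0) (l 1) * sphericalCos (l 0) (l 1) (l 2) =
      Real.cos (l 1) * (Real.sin (l 2) * Real.sin (l 0) * sphericalDisc l)
    simp only [sphericalCos, sphericalDisc]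
    field_simp
    simp only [Real.sin_sq]
    ring
  · change sphericalCos (l 2) (l 0) (l 1) +
      sphericalCos (l 0) (l 1) (l 2) * sphericalCos (l 1) (l 2) (l 0) =
      Real.cos (l 2) * (Real.sin (l 0) * Real.sin (l 1) * sphericalDisc l)
    simp only [sphericalCos, sphericalDisc]
    field_simp
    simp only [Real.sin_sq]
    ring

/-- This is the dual cosine law, obtained from `sphericalCos_add_mul` and the sine law. -/
theorem lawAngle_polar {l : Fin 3 → ℝ} (hl : ∀ i, l i ∈ Ioo 0 π) (hR : 0 < sphericalDisc l)
    (i : Fin 3) : lawAngle sphericalCos (polar l) i = π - l i := by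
  have hcos : ∀ j, Real.cos (polar l j) = -sphericalCos (l j) (l (j + 1)) (l (j + 2)) := fun j => by
    have := abs_lt.1 (spherical_cosineLaw.abs_lt_one hl hR j)
    rw [polar, Real.cos_pi_sub, lawAngle, Real.cos_arccos this.1.le this.2.le]
  have hsin : ∀ j, Real.sin (polar l j) = Real.sin (l j) * √(sphericalDisc l) := fun j => by
    rw [polar, Real.sin_pi_sub, spherical_cosineLaw.sin_lawAngle hl]
  have h1 := (Real.sin_pos_of_mem_Ioo (hl (i + 1))).ne'
  have h2 := (Real.sin_pos_of_mem_Ioo (hl (i + 2))).ne'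
  have hs : √(sphericalDisc l) ≠ 0 := (Real.sqrt_pos.2 hR).ne'
  have key : sphericalCos (polar l i) (polar l (i + 1)) (polar l (i + 2)) = -Real.cos (l i) := by
    have h3 := sphericalCos_add_mul hl i
    have e1 : i + 1 + 1 = i + 2 := by rw [add_assoc]; rfl
    have e2 : i + 1 + 2 = i := by rw [add_assoc]; exact add_zero i
    have e3 : i + 2 + 1 = i := by rw [add_assoc]; exact add_zero i
    have e4 : i + 2 + 2 = i + 1 := by rw [add_assoc]; rfl
    have h4 := hcos (i + 1)
    have h5 := hcos (i + 2)
    rw [e1, e2] at h4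
    rw [e3, e4] at h5
    rw [sphericalCos, hcos i, h4, h5, hsin, hsin, div_eq_iff (by positivity)]
    have hsq := Real.mul_self_sqrt hR.le
    linear_combination -h3 + Real.cos (l i) * Real.sin (l (i + 1)) * Real.sin (l (i + 2)) * hsq
  rw [lawAngle, key, Real.arccos_neg, Real.arccos_cos (hl i).1.le (hl i).2.le]

theorem sphericalDisc_polar_pos {l : Fin 3 → ℝ} (hl : ∀ i, l i ∈ Ioo 0 π)
    (hR : 0 < sphericalDisc l) : 0 < sphericalDisc (polar l) := by
  have h1 := spherical_cosineLaw.sin_lawAngle (polar_mem_Ioo hl hR) 0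
  rw [lawAngle_polar hl hR, Real.sin_pi_sub] at h1
  have h2 := Real.sin_pos_of_mem_Ioo (hl 0)
  rw [h1] at h2
  exact Real.sqrt_pos.1 (pos_of_mul_pos_right h2
    (Real.sin_pos_of_mem_Ioo (polar_mem_Ioo hl hR 0)).le)

theorem integral_sin_rpow_pi_sub (h x y : ℝ) :
    ∫ t in (π - x)..(π - y), Real.sin t ^ h = -∫ t in x..y, Real.sin t ^ h := by
  have := integral_comp_sub_left (a := x) (b := y) (fun t => Real.sin t ^ h) π
  simp only [Real.sin_pi_sub] at this
  rw [this, integral_symm]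

theorem spherical_monotonicity_of_neg_one_lt {h : ℝ} (hh : -1 < h) {l l' : Fin 3 → ℝ}
    (hl : ∀ i, l i ∈ Ioo 0 π) (hl' : ∀ i, l' i ∈ Ioo 0 π) (hR : 0 < sphericalDisc l) :
    0 ≤ ∑ i, (sinPowPrimitive h (lawAngle sphericalCos l' i) -
      sinPowPrimitive h (lawAngle sphericalCos l i)) *
        ∫ s in (l i)..(l' i), Real.sin s ^ (-h - 1) ∧
    (∑ i, (sinPowPrimitive h (lawAngle sphericalCos l' i) -
      sinPowPrimitive h (lawAngle sphericalCos l i)) *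
        ∫ s in (l i)..(l' i), Real.sin s ^ (-h - 1) = 0 → l = l') := by
  obtain ⟨g, rfl, rfl, hg, -⟩ := exists_lawPath isOpen_Ioo ordConnected_Ioo
    spherical_cosineLaw.pos spherical_cosineLaw.continuousOn h hl hl'
  refine (spherical_cosineLaw.monotonicity_of_path hg (Or.inl hh) hR).imp_right
    fun H heq => ?_
  have hv := H heq
  contrapose hv
  refine (lawForm_spherical_pos hl hR fun hv0 => hv (funext fun i => ?_)).ne'
  refine eq_of_integral_eq_zero ordConnected_Ioo
    (w := fun s => Real.sin s ^ (-h - 1))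
    (fun x hx => (continuousAt_sin_rpow _ (Real.sin_pos_of_mem_Ioo hx).ne').continuousWithinAt)
    (fun x hx => Real.rpow_pos_of_pos (Real.sin_pos_of_mem_Ioo hx) _) (hl i) (hl' i) ?_
  exact (mul_eq_zero.1 (congrFun hv0 i)).resolve_right
    (Real.rpow_pos_of_pos (Real.sin_pos_of_mem_Ioo (hl i)) _).ne'

/-- For `h ≤ -1`, passing to polar triangles exchanges angles and sides up to `π - ·`. The two
factors in each summand are swapped, both with a change of sign, and `h` becomes `-h - 1 ≥ 0`, so
the previous case applies. -/
theorem spherical_monotonicity (h : ℝ) {l l' : Fin 3 → ℝ}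
    (hl : ∀ i, l i ∈ Ioo 0 π) (hl' : ∀ i, l' i ∈ Ioo 0 π) (hR : 0 < sphericalDisc l)
    (hR' : 0 < sphericalDisc l') :
    0 ≤ ∑ i, (sinPowPrimitive h (lawAngle sphericalCos l' i) -
      sinPowPrimitive h (lawAngle sphericalCos l i)) *
        ∫ s in (l i)..(l' i), Real.sin s ^ (-h - 1) ∧
    (∑ i, (sinPowPrimitive h (lawAngle sphericalCos l' i) -
      sinPowPrimitive h (lawAngle sphericalCos l i)) *
        ∫ s in (l i)..(l' i), Real.sin s ^ (-h - 1) = 0 → l = l') := by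
  rcases lt_or_ge (-1) h with hh | hh
  · exact spherical_monotonicity_of_neg_one_lt hh hl hl' hR
  have hp := polar_mem_Ioo hl hR
  have hp' := polar_mem_Ioo hl' hR'
  have key := spherical_monotonicity_of_neg_one_lt (h := -h - 1) (by linarith) hp hp'
    (sphericalDisc_polar_pos hl hR)
  have hsum : ∀ i, (sinPowPrimitive (-h - 1) (lawAngle sphericalCos (polar l') i) -
      sinPowPrimitive (-h - 1) (lawAngle sphericalCos (polar l) i)) *
        ∫ s in (polar l i)..(polar l' i), Real.sin s ^ (-(-h - 1) - 1) =
      (sinPowPrimitive h (lawAngle sphericalCos l' i) -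
      sinPowPrimitive h (lawAngle sphericalCos l i)) *
        ∫ s in (l i)..(l' i), Real.sin s ^ (-h - 1) := fun i => by
    have hm : ∀ {x : ℝ}, x ∈ Ioo 0 π → π - x ∈ Ioo 0 π := fun hx =>
      ⟨by linarith [hx.2], by linarith [hx.1]⟩
    rw [lawAngle_polar hl hR, lawAngle_polar hl' hR',
      sinPowPrimitive_sub _ (hm (hl i)) (hm (hl' i)),
      sinPowPrimitive_sub _ (spherical_cosineLaw.lawAngle_mem_Ioo hl hR i)
        (spherical_cosineLaw.lawAngle_mem_Ioo hl' hR' i), polar, polar,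
      integral_sin_rpow_pi_sub, integral_sin_rpow_pi_sub]
    ring_nf
  simp only [hsum] at key
  refine key.imp_right fun H heq => funext fun i => ?_
  have h1 := lawAngle_polar hl hR i
  rw [H heq, lawAngle_polar hl' hR'] at h1
  linarith

/-! ### Hyperbolic triangles -/

theorem hyperbolic_monotonicity (h : ℝ) {l l' : Fin 3 → ℝ} (hl : TriangleIneq l)
    (hl' : TriangleIneq l') :
    0 ≤ ∑ i, (sinPowPrimitive h (lawAngle hyperbolicCos l' i) -
      sinPowPrimitive h (lawAngle hyperbolicCos l i)) *
        ∫ s in (l i)..(l' i), Real.tanh (s / 2) ^ (-h - 1) ∧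
    (∑ i, (sinPowPrimitive h (lawAngle hyperbolicCos l' i) -
      sinPowPrimitive h (lawAngle hyperbolicCos l i)) *
        ∫ s in (l i)..(l' i), Real.tanh (s / 2) ^ (-h - 1) = 0 → l = l') := by
  have C := hyperbolic_cosineLaw
  obtain ⟨g, rfl, rfl, hg, hint⟩ := exists_lawPath isOpen_Ioi ordConnected_Ioi
    C.pos C.continuousOn h hl.pos hl'.pos
  have hcase : -1 < h ∨ ∀ t ∈ Icc (0 : ℝ) 1, 0 < hyperbolicDisc (g t) := by
    rcases lt_or_ge (-1) h with hh | hh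
    · exact Or.inl hh
    · refine Or.inr fun t ht => hyperbolicDisc_pos ?_
      exact triangleIneq_of_path (k := Real.sinh) C.pos (fun x hx => Real.sinh_pos_iff.2 hx)
        (fun x hx y hy => sinh_add_sinh_le hx.le hy.le) (fun x hx => hasDerivAt_tanh_half hx) hh hg
        hint hl hl' ht
  refine (C.monotonicity_of_path hg hcase (hyperbolicDisc_pos hl)).imp_right
    fun H heq => ?_
  have hv := H heq
  contrapose hv
  refine (lawForm_hyperbolic_pos hl.pos (hyperbolicDisc_pos hl)
    fun hv0 => hv (funext fun i => ?_)).ne'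
  refine eq_of_integral_eq_zero ordConnected_Ioi
    (w := fun s => Real.tanh (s / 2) ^ (-h - 1))
    (C.continuousOn.rpow_const fun x hx => Or.inl (C.pos x hx).ne')
    (fun x hx => Real.rpow_pos_of_pos (C.pos x hx) _) (hl.pos i) (hl'.pos i) ?_
  exact (mul_eq_zero.1 (congrFun hv0 i)).resolve_right
    (Real.rpow_pos_of_pos (C.pos _ (hl.pos i)) _).ne'

/-- The half-angle formulas: with sides `y + z`, `z + x`, `x + y`, the half perimeter is `x + y + z`
and the triangle inequalities become positivity of `x`, `y`, `z`. -/
theorem sin_cos_half_innerAngle_hyperbolic {x y z : ℝ} (hx : 0 < x) (hy : 0 < y) (hz : 0 < z) :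
    Real.sin (innerAngle .hyperbolic (y + z) (z + x) (x + y) / 2) =
      √(Real.sinh y) * √(Real.sinh z) / (√(Real.sinh (z + x)) * √(Real.sinh (x + y))) ∧
    Real.cos (innerAngle .hyperbolic (y + z) (z + x) (x + y) / 2) =
      √(Real.sinh (x + y + z)) * √(Real.sinh x) /
        (√(Real.sinh (z + x)) * √(Real.sinh (x + y))) := by
  have sx := Real.sinh_pos_iff.2 hx
  have sy := Real.sinh_pos_iff.2 hy
  have sz := Real.sinh_pos_iff.2 hz
  have sb := Real.sinh_pos_iff.2 (add_pos hz hx)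
  have sc := Real.sinh_pos_iff.2 (add_pos hx hy)
  have ss := Real.sinh_pos_iff.2 (add_pos (add_pos hx hy) hz)
  set X := (Real.cosh (z + x) * Real.cosh (x + y) - Real.cosh (y + z)) /
    (Real.sinh (z + x) * Real.sinh (x + y)) with hX
  have h1 : (1 - X) / 2 = Real.sinh y * Real.sinh z / (Real.sinh (z + x) * Real.sinh (x + y)) := by
    rw [hX]
    field_simp
    simp only [Real.sinh_add, Real.cosh_add]
    have e := Real.cosh_sq x
    linear_combination (Real.sinh y * Real.sinh z - Real.cosh y * Real.cosh z) * e
  have h2 : (1 + X) / 2 =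
      Real.sinh (x + y + z) * Real.sinh x / (Real.sinh (z + x) * Real.sinh (x + y)) := by
    rw [hX]
    field_simp
    simp only [Real.sinh_add, Real.cosh_add]
    have e := Real.cosh_sq x
    linear_combination (Real.cosh y * Real.cosh z + Real.sinh y * Real.sinh z) * e
  have hX1 : X ≤ 1 := by
    have : 0 ≤ (1 - X) / 2 := by rw [h1]; positivity
    linarith
  have hX2 : -1 ≤ X := by
    have : 0 ≤ (1 + X) / 2 := by rw [h2]; positivity
    linarith
  have hA : innerAngle .hyperbolic (y + z) (z + x) (x + y) = Real.arccos X := rfl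
  have hA0 := Real.arccos_nonneg X
  have hA1 := Real.arccos_le_pi X
  rw [hA, Real.sin_half_eq_sqrt hA0 (by linarith), Real.cos_half (by linarith) hA1,
    Real.cos_arccos hX2 hX1, h1, h2, Real.sqrt_div (by positivity), Real.sqrt_div (by positivity),
    Real.sqrt_mul sy.le, Real.sqrt_mul ss.le, Real.sqrt_mul sb.le]
  exact ⟨rfl, rfl⟩

theorem hyperbolicCos_eq {x y z : ℝ} (hx : 0 < x) (hy : 0 < y) (hz : 0 < z) :
    hyperbolicCos (y + z) (z + x) (x + y) =
      (Real.sinh (x + y + z) * (Real.sinh x * Real.sinh z + Real.sinh x * Real.sinh y -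
        Real.sinh y * Real.sinh z) + Real.sinh x * Real.sinh y * Real.sinh z) /
      (Real.sinh (y + z) * Real.sinh (z + x) * Real.sinh (x + y)) := by
  obtain ⟨a, rfl⟩ : ∃ a, x = 2 * a := ⟨x / 2, by ring⟩
  obtain ⟨b, rfl⟩ : ∃ b, y = 2 * b := ⟨y / 2, by ring⟩
  obtain ⟨c, rfl⟩ : ∃ c, z = 2 * c := ⟨z / 2, by ring⟩
  have hs : ∀ t, Real.sinh (2 * t) = 2 * Real.sinh t * Real.cosh t := fun t => by
    rw [Real.sinh_two_mul]
  have ha : 0 < Real.sinh (b + c) := Real.sinh_pos_iff.2 (by linarith)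
  have hb : 0 < Real.sinh (c + a) := Real.sinh_pos_iff.2 (by linarith)
  have hc : 0 < Real.sinh (a + b) := Real.sinh_pos_iff.2 (by linarith)
  have ca := Real.cosh_pos (b + c)
  have cb := Real.cosh_pos (c + a)
  have cc := Real.cosh_pos (a + b)
  simp only [hyperbolicCos, ← mul_add, mul_div_cancel_left₀ _ (two_ne_zero' ℝ)]
  rw [hs (b + c), hs (c + a), hs (a + b), div_eq_div_iff (by positivity) (by positivity)]
  have key : (Real.sinh (c + a) ^ 2 + Real.sinh (a + b) ^ 2 - Real.sinh (b + c) ^ 2) *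
      (4 * Real.sinh (b + c) * Real.cosh (c + a) * Real.cosh (a + b)) =
      Real.sinh (2 * (a + b + c)) * (Real.sinh (2 * a) * Real.sinh (2 * c) +
        Real.sinh (2 * a) * Real.sinh (2 * b) - Real.sinh (2 * b) * Real.sinh (2 * c)) +
        Real.sinh (2 * a) * Real.sinh (2 * b) * Real.sinh (2 * c) := by
    -- In exponentials of `a`, `b`, `c` the claim is an identity of rational functions.
    simp only [Real.sinh_eq, Real.cosh_eq, mul_add, neg_add, two_mul, Real.exp_add, Real.exp_neg]
    have := (Real.exp_pos a).ne'
    have := (Real.exp_pos b).ne'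
    have := (Real.exp_pos c).ne'
    field_simp
    ring
  linear_combination (2 * Real.cosh (b + c) * Real.sinh (c + a) * Real.sinh (a + b)) * key

theorem arccos_hyperbolicCos {x y z : ℝ} (hx : 0 < x) (hy : 0 < y) (hz : 0 < z) :
    Real.arccos (hyperbolicCos (y + z) (z + x) (x + y)) =
      π / 2 - (innerAngle .hyperbolic (z + x) (x + y) (y + z) +
        innerAngle .hyperbolic (x + y) (y + z) (z + x) -
        innerAngle .hyperbolic (y + z) (z + x) (x + y)) / 2 := by
  obtain ⟨sA, cA⟩ := sin_cos_half_innerAngle_hyperbolic hx hy hz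
  obtain ⟨sB, cB⟩ := sin_cos_half_innerAngle_hyperbolic hy hz hx
  obtain ⟨sC, cC⟩ := sin_cos_half_innerAngle_hyperbolic hz hx hy
  rw [show y + z + x = x + y + z by ring] at cB
  rw [show z + x + y = x + y + z by ring] at cC
  have hA0 : 0 ≤ innerAngle .hyperbolic (y + z) (z + x) (x + y) := Real.arccos_nonneg _
  have hB0 : 0 ≤ innerAngle .hyperbolic (z + x) (x + y) (y + z) := Real.arccos_nonneg _
  have hC0 : 0 ≤ innerAngle .hyperbolic (x + y) (y + z) (z + x) := Real.arccos_nonneg _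
  have hA1 : innerAngle .hyperbolic (y + z) (z + x) (x + y) ≤ π := Real.arccos_le_pi _
  have hB1 : innerAngle .hyperbolic (z + x) (x + y) (y + z) ≤ π := Real.arccos_le_pi _
  have hC1 : innerAngle .hyperbolic (x + y) (y + z) (z + x) ≤ π := Real.arccos_le_pi _
  set A := innerAngle .hyperbolic (y + z) (z + x) (x + y)
  set B := innerAngle .hyperbolic (z + x) (x + y) (y + z)
  set C := innerAngle .hyperbolic (x + y) (y + z) (z + x)
  have sx := Real.sinh_pos_iff.2 hx
  have sy := Real.sinh_pos_iff.2 hy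
  have sz := Real.sinh_pos_iff.2 hz
  have sa := Real.sinh_pos_iff.2 (add_pos hy hz)
  have sb := Real.sinh_pos_iff.2 (add_pos hz hx)
  have sc := Real.sinh_pos_iff.2 (add_pos hx hy)
  have ss := Real.sinh_pos_iff.2 (add_pos (add_pos hx hy) hz)
  have hxs : Real.sinh x ≤ Real.sinh (x + y + z) := Real.sinh_le_sinh.2 (by linarith)
  have qx := Real.sq_sqrt sx.le
  have qy := Real.sq_sqrt sy.le
  have qz := Real.sq_sqrt sz.le
  have qa := Real.sq_sqrt sa.le
  have qb := Real.sq_sqrt sb.le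
  have qc := Real.sq_sqrt sc.le
  have qs := Real.sq_sqrt ss.le
  have pa := Real.sqrt_pos.2 sa
  have pb := Real.sqrt_pos.2 sb
  have pc := Real.sqrt_pos.2 sc
  -- This bound keeps `(B + C - A) / 2` in `[-π / 2, π / 2]`, where `arcsin` inverts `sin`. It holds
  -- since `cos (B / 2 + C / 2)` is a nonnegative multiple of `sinh (x + y + z) - sinh x`.
  have hle : B / 2 + C / 2 ≤ π / 2 := by
    by_contra! hlt
    have hneg := Real.cos_neg_of_pi_div_two_lt_of_lt hlt (by linarith [Real.pi_pos])
    have : Real.cos (B / 2 + C / 2) = √(Real.sinh y) * √(Real.sinh z) *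
        (Real.sinh (x + y + z) - Real.sinh x) /
        (√(Real.sinh (x + y)) * Real.sinh (y + z) * √(Real.sinh (z + x))) := by
      rw [Real.cos_add, cB, cC, sB, sC, ← qs, ← qx, ← qa]
      simp only [Real.sqrt_sq (Real.sqrt_nonneg _)]
      field_simp
    rw [this] at hneg
    have h0 := sub_nonneg.2 hxs
    exact absurd hneg (not_lt.2 (by positivity))
  have hsin : Real.sin ((B + C - A) / 2) = hyperbolicCos (y + z) (z + x) (x + y) := by
    rw [hyperbolicCos_eq hx hy hz, show (B + C - A) / 2 = B / 2 + C / 2 - A / 2 by ring,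
      Real.sin_sub, Real.sin_add, Real.cos_add, sA, cA, sB, cB, sC, cC,
      ← qs, ← qx, ← qy, ← qz, ← qa, ← qb, ← qc]
    simp only [Real.sqrt_sq (Real.sqrt_nonneg _)]
    field_simp
    ring
  rw [← hsin, Real.arccos, Real.arcsin_sin (by linarith) (by linarith)]

theorem lawAngle_hyperbolicCos {l : Fin 3 → ℝ} (hl : TriangleIneq l) (i : Fin 3) :
    lawAngle hyperbolicCos l i =
      π / 2 - (innerAngle .hyperbolic (l (i + 1)) (l (i + 2)) (l i) +
        innerAngle .hyperbolic (l (i + 2)) (l i) (l (i + 1)) -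
        innerAngle .hyperbolic (l i) (l (i + 1)) (l (i + 2))) / 2 := by
  have e1 : i + 1 + 1 = i + 2 := by rw [add_assoc]; rfl
  have e2 : i + 1 + 2 = i := by rw [add_assoc]; exact add_zero i
  have e3 : i + 2 + 1 = i := by rw [add_assoc]; exact add_zero i
  have e4 : i + 2 + 2 = i + 1 := by rw [add_assoc]; rfl
  have h0 := hl i
  have h1 := hl (i + 1)
  have h2 := hl (i + 2)
  rw [e1, e2] at h1
  rw [e3, e4] at h2
  obtain ⟨x, hx⟩ : ∃ x, x = (l (i + 1) + l (i + 2) - l i) / 2 := ⟨_, rfl⟩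
  obtain ⟨y, hy⟩ : ∃ y, y = (l (i + 2) + l i - l (i + 1)) / 2 := ⟨_, rfl⟩
  obtain ⟨z, hz⟩ : ∃ z, z = (l i + l (i + 1) - l (i + 2)) / 2 := ⟨_, rfl⟩
  rw [lawAngle, show l i = y + z by linarith, show l (i + 1) = z + x by linarith,
    show l (i + 2) = x + y by linarith]
  exact arccos_hyperbolicCos (by linarith) (by linarith) (by linarith)

/-! ### Summation over the triangles and connectedness -/

/-- Reindexing by the involution `glue` fixes `q` and negates `p`, so the sum equals its own
negative. -/
theorem SideGluing.sum_mul_edge_eq_zero {F : Type*} [Fintype F] (G : SideGluing F)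
    {p : F × Fin 3 → ℝ} (hp : ∀ s, p s + p (G.glue s) = 0) (q : G.Edge → ℝ) :
    ∑ f, ∑ i, p (f, i) * q (G.edge f i) = 0 := by
  rw [← Fintype.sum_prod_type' (f := fun f i => p (f, i) * q (G.edge f i))]
  have hedge : ∀ s : F × Fin 3, G.edge (G.glue s).1 (G.glue s).2 = G.edge s.1 s.2 := fun s =>
    (Quotient.sound (s := G.sideSetoid) (Or.inr rfl : G.glue s = s ∨ G.glue s = G.glue s)).symm
  have h1 := Equiv.sum_comp (Function.Involutive.toPerm G.glue G.glue_glue)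
    fun s : F × Fin 3 => p (s.1, s.2) * q (G.edge s.1 s.2)
  have h2 : ∑ s : F × Fin 3, p (G.glue s) * q (G.edge s.1 s.2) =
      ∑ s : F × Fin 3, p s * q (G.edge s.1 s.2) := by
    rw [← h1]
    exact Finset.sum_congr rfl fun s _ => by
      change _ = p (G.glue s) * q (G.edge (G.glue s).1 (G.glue s).2)
      rw [hedge]
  have h3 : ∑ s : F × Fin 3, p (G.glue s) * q (G.edge s.1 s.2) =
      -∑ s : F × Fin 3, p s * q (G.edge s.1 s.2) := by
    rw [← Finset.sum_neg_distrib]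
    exact Finset.sum_congr rfl fun s _ => by rw [eq_neg_of_add_eq_zero_right (hp s)]; ring
  simp only [Prod.mk.eta]
  linarith

namespace Triangulation

variable {S : Type*} [TopologicalSpace S] {F : Type*} (T : Triangulation S F)

theorem edge_surjective (e : T.Edge) : ∃ f i, T.edge f i = e := by
  obtain ⟨⟨f, i⟩, rfl⟩ := Quotient.exists_rep e
  exact ⟨f, i, rfl⟩

theorem edge_glue {f g : F} {i j : Fin 3} (h : T.glue (f, i) = (g, j)) :
    T.edge f i = T.edge g j :=
  Quotient.sound (s := T.sideSetoid) (Or.inr h.symm)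

/-- If the contributions `A₁` and `A₂` of the sides add up to the same function on the edges, and
in each triangle their difference is a monotone function of the edge function `q`, then the
difference is orthogonal to `q` in each triangle. -/
theorem sum_triangle_eq_zero [Finite F] {A₁ A₂ : F × Fin 3 → ℝ}
    (hA : T.edgeSum A₁ = T.edgeSum A₂) (q : T.Edge → ℝ)
    (hnonneg : ∀ f, 0 ≤ ∑ i, (A₂ (f, i) - A₁ (f, i)) * q (T.edge f i)) (f : F) :
    ∑ i, (A₂ (f, i) - A₁ (f, i)) * q (T.edge f i) = 0 := by
  have := Fintype.ofFinite F
  have hsum := T.sum_mul_edge_eq_zero (p := fun s => A₂ s - A₁ s) (fun s => by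
    have h1 : A₁ s + A₁ (T.glue s) = A₂ s + A₂ (T.glue s) := congrFun hA (T.edge s.1 s.2)
    linarith) q
  exact (Finset.sum_eq_zero_iff_of_nonneg fun f _ => hnonneg f).1 hsum f (Finset.mem_univ f)

/-- The condition `c = c f` is open and closed on the disjoint union of triangles and compatible
with gluing, so it defines a nonempty clopen subset of the connected realization. -/
theorem eq_of_forall_glue [ConnectedSpace S] {c : F → ℝ}
    (hc : ∀ f g i j, T.glue (f, i) = (g, j) → c f = c g) (f g : F) : c f = c g := by
  have hconn : ConnectedSpace T.Realization := T.homeo.symm.surjective.connectedSpace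
    T.homeo.symm.continuous
  let d : T.Realization → Prop := Quot.lift (fun p => c p.1 = c f) (by
    rintro p q ⟨i, j, hij, -⟩
    simp only [hc _ _ _ _ hij])
  have hd : IsClopen {x | d x} := by
    have h1 : IsClopen {p : Σ _ : F, stdSimplex ℝ (Fin 3) | c p.1 = c f} := by
      have h2 : ∀ A : Set F, IsOpen {p : Σ _ : F, stdSimplex ℝ (Fin 3) | p.1 ∈ A} := fun A =>
        isOpen_sigma_iff.2 fun i => by
          by_cases hi : i ∈ A
          · simp [hi]
          · simp [hi]
      exact ⟨⟨h2 {i | ¬ c i = c f}⟩, h2 {i | c i = c f}⟩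
    exact ⟨isQuotientMap_quot_mk.isClosed_preimage.1 h1.1,
      isQuotientMap_quot_mk.isOpen_preimage.1 h1.2⟩
  have pt : stdSimplex ℝ (Fin 3) := ⟨_, single_mem_stdSimplex ℝ (0 : Fin 3)⟩
  have huniv := hd.eq_univ ⟨Quot.mk _ ⟨f, pt⟩, rfl⟩
  have : Quot.mk _ ⟨g, pt⟩ ∈ {x | d x} := huniv ▸ mem_univ _
  exact Eq.symm this

theorem IsPolyhedralMetric.triangleIneq {T : Triangulation S F} {K : Geometry} {l : T.Edge → ℝ}
    (hl : T.IsPolyhedralMetric K l) (f : F) : TriangleIneq fun i => l (T.edge f i) := hl.1 f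

end Triangulation

theorem theorem1p2 {S : Type*} [TopologicalSpace S] [ConnectedSpace S] {F : Type*} [Finite F]
    (T : Triangulation S F) (h : ℝ) :
    (∀ l₁ l₂ : T.Edge → ℝ,
      T.IsPolyhedralMetric Geometry.euclidean l₁ → T.IsPolyhedralMetric Geometry.euclidean l₂ →
      T.phiCurvature Geometry.euclidean h l₁ = T.phiCurvature Geometry.euclidean h l₂ →
      ∃ c : ℝ, 0 < c ∧ ∀ e, l₂ e = c * l₁ e) ∧
    (∀ l₁ l₂ : T.Edge → ℝ,
      T.IsPolyhedralMetric Geometry.spherical l₁ → T.IsPolyhedralMetric Geometry.spherical l₂ →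
      T.phiCurvature Geometry.spherical h l₁ = T.phiCurvature Geometry.spherical h l₂ →
      l₁ = l₂) ∧
    (∀ l₁ l₂ : T.Edge → ℝ,
      T.IsPolyhedralMetric Geometry.hyperbolic l₁ → T.IsPolyhedralMetric Geometry.hyperbolic l₂ →
      T.psiCurvature Geometry.hyperbolic h l₁ = T.psiCurvature Geometry.hyperbolic h l₂ →
      l₁ = l₂) := by
  refine ⟨fun l₁ l₂ hl₁ hl₂ hcurv => ?_, fun l₁ l₂ hl₁ hl₂ hcurv => ?_,
    fun l₁ l₂ hl₁ hl₂ hcurv => ?_⟩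
  · have key := fun f => euclidean_monotonicity h (hl₁.triangleIneq f) (hl₂.triangleIneq f)
    -- By definition `phiSide` is `sinPowPrimitive` of the angle, so the one-triangle inequality
    -- applies directly.
    have hzero := T.sum_triangle_eq_zero hcurv (fun e => ∫ s in (l₁ e)..(l₂ e), s ^ (-h - 1))
      fun f => (key f).1
    choose c hc hcl using fun f => (key f).2 (hzero f)
    obtain ⟨p, -⟩ := Quot.exists_rep (T.homeo.symm (Classical.arbitrary S))
    refine ⟨c p.1, hc p.1, fun e => ?_⟩
    obtain ⟨f, i, rfl⟩ := T.edge_surjective e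
    -- Two glued triangles share an edge of positive length, so their scaling factors agree.
    rw [T.eq_of_forall_glue (c := c) (fun f g i j hij => ?_) p.1 f]
    · exact hcl f i
    · have h1 := hcl f i
      have h2 := hcl g j
      have hpos := (hl₁.triangleIneq f).pos i
      simp only [T.edge_glue hij] at h1 hpos
      exact mul_right_cancel₀ hpos.ne' (h1.symm.trans h2)
  · have key := fun f => spherical_monotonicity h
      ((hl₁.triangleIneq f).mem_Ioo (hl₁.2 rfl f)) ((hl₂.triangleIneq f).mem_Ioo (hl₂.2 rfl f))
      (sphericalDisc_pos (hl₁.triangleIneq f) (hl₁.2 rfl f))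
      (sphericalDisc_pos (hl₂.triangleIneq f) (hl₂.2 rfl f))
    have hzero := T.sum_triangle_eq_zero hcurv
      (fun e => ∫ s in (l₁ e)..(l₂ e), Real.sin s ^ (-h - 1)) fun f => (key f).1
    funext e
    obtain ⟨f, i, rfl⟩ := T.edge_surjective e
    exact congrFun ((key f).2 (hzero f)) i
  · have hpsi : ∀ l : T.Edge → ℝ, T.IsPolyhedralMetric Geometry.hyperbolic l → ∀ f i,
        T.psiSide Geometry.hyperbolic h l (f, i) =
          -sinPowPrimitive h (lawAngle hyperbolicCos (fun i => l (T.edge f i)) i) :=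
      fun l hl f i => by
        have e1 : i + 1 + 1 = i + 2 := by rw [add_assoc]; rfl
        have e2 : i + 1 + 2 = i := by rw [add_assoc]; exact add_zero i
        have e3 : i + 2 + 1 = i := by rw [add_assoc]; exact add_zero i
        have e4 : i + 2 + 2 = i + 1 := by rw [add_assoc]; rfl
        rw [Triangulation.psiSide, integral_cos_rpow_eq, lawAngle_hyperbolicCos (hl.triangleIneq f)]
        simp only [Triangulation.angle, e1, e2, e3, e4]
    have key := fun f => hyperbolic_monotonicity h (hl₁.triangleIneq f) (hl₂.triangleIneq f)
    have hsum : ∀ f, ∑ i, (T.psiSide Geometry.hyperbolic h l₁ (f, i) -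
        T.psiSide Geometry.hyperbolic h l₂ (f, i)) *
          ∫ s in (l₁ (T.edge f i))..(l₂ (T.edge f i)), Real.tanh (s / 2) ^ (-h - 1) =
        ∑ i, (sinPowPrimitive h (lawAngle hyperbolicCos (fun i => l₂ (T.edge f i)) i) -
          sinPowPrimitive h (lawAngle hyperbolicCos (fun i => l₁ (T.edge f i)) i)) *
          ∫ s in (l₁ (T.edge f i))..(l₂ (T.edge f i)), Real.tanh (s / 2) ^ (-h - 1) := fun f =>
      Finset.sum_congr rfl fun i _ => by rw [hpsi l₁ hl₁, hpsi l₂ hl₂]; ring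
    -- The minus sign in `hpsi` makes the roles of the two metrics trade places.
    have hzero := T.sum_triangle_eq_zero hcurv.symm
      (fun e => ∫ s in (l₁ e)..(l₂ e), Real.tanh (s / 2) ^ (-h - 1))
      fun f => (key f).1.trans_eq (hsum f).symm
    funext e
    obtain ⟨f, i, rfl⟩ := T.edge_surjective e
    exact congrFun ((key f).2 ((hsum f).symm.trans (hzero f))) i

end
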